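/- **Definitions.** A singular cardinal is an infinite cardinal $\mu$ with $\mathrm{cf}(\mu)<\mu$. For a set $a$ of regular cardinals and an ultrafilter $D$ on $a$, $\mathrm{cf}(\prod a/D)$ is the least size of a cofinal subset of the ultraproduct $\prod a/D=\prod_{\theta\in a}\theta/D$, ordered by $f\le_D g\iff\{\theta\in a\mid f(\theta)\le g(\theta)\}\in D$, and $$\mathrm{pcf}(a)=\{\mathrm{cf}(\textstyle\prod a/D)\mid D\text{ an ultrafilter on }a\}.$$ For a singular cardinal $\mu$, $\mathrm{pp}(\mu)$ is the supremum of all cardinals $\mathrm{cf}(\prod a/D)$ where $a$ is an unbounded set of regular cardinals below $\mu$ with $|a|=\mathrm{cf}(\mu)$ and $D$ is an ultrafilter on $a$ no element of which is bounded below $\mu$. **Theorem.** Let $\kappa$ be a singular cardinal of uncountable cofinality. Suppose that $(*)_\kappa$ there is a strictly increasing and continuous sequence $(\kappa_i\mid i<\mathrm{cf}(\kappa))$ of singular cardinals which is cofinal in $\kappa$ and such that for every limit ordinal $i$ with $0<i<\mathrm{cf}(\kappa)$, the set $\mathrm{pcf}(\{\kappa_j^+\mid j<i\})$ has a maximum and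 $$\kappa_i^+=\max\bigl(\mathrm{pcf}(\{\kappa_j^+\mid j<i\})\bigr).$$ Then either the set of all singular cardinals $\alpha<\kappa$ with $\mathrm{pp}(\alpha)=\alpha^+$ contains a closed unbounded subset of $\kappa$, or else the set of all singular cardinals $\alpha<\kappa$ with $\mathrm{pp}(\alpha)>\alpha^+$ contains a closed unbounded subset of $\kappa$. -/

import Mathlib

universe u

namespace Pcf

open Cardinal

/-- A singular cardinal: an infinite cardinal that is greater than its cofinality. -/
def IsSingular (μ : Cardinal.{u}) : Prop :=
  ℵ₀ ≤ μ ∧ μ.ord.cof < μ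

/-- The product `∏ a` of a set `a` of cardinals, each `θ ∈ a` being identified with the set of
ordinals below it. The filter `D` only serves to determine the order below. -/
def UProd (a : Set Cardinal.{u}) (_D : Ultrafilter a) : Type (u + 1) :=
  ∀ θ : a, Set.Iio (θ : Cardinal.{u}).ord

/-- The ordering `≤_D` of `∏ a`. Since `D` is an ultrafilter, the associated strict relation
(`f ≤ g` and not `g ≤ f`) is `f θ < g θ` for `D`-almost all `θ`, and the quotient of
this preorder is the linearly ordered ultraproduct `∏ a / D`. -/
instance (a : Set Cardinal.{u}) (D : Ultrafilter a) : Preorder (UProd a D) where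
  le f g := ∀ᶠ θ in (D : Filter a), f θ ≤ g θ
  le_refl _ := Filter.Eventually.of_forall fun _ => le_rfl
  le_trans _ _ _ h₁ h₂ := by
    filter_upwards [h₁, h₂] with θ h h'
    exact h.trans h'

/-- `cf(∏ a / D)`, the least size of a cofinal subset. As `a` lives in a higher universe, so does
this cardinal; for a small `a` it is always the lift of a cardinal in the original universe. -/
noncomputable def cofProd (a : Set Cardinal.{u}) (D : Ultrafilter a) : Cardinal.{u + 1} :=
  Order.cof (UProd a D)

/-- The set of possible cofinalities `pcf(a) = {cf(∏ a / D) | D an ultrafilter on a}`; it is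
meant for sets `a` of regular cardinals. -/
def pcf (a : Set Cardinal.{u}) : Set Cardinal.{u} :=
  {χ | ∃ D : Ultrafilter a, cofProd a D = lift.{u + 1} χ}

/-- The cofinalities of which the pseudopower of `μ` is the supremum: all `cf(∏ a / D)` where
`a` is an unbounded subset of the set of regular cardinals below `μ`, of size `cf(μ)`, and
`D` is an ultrafilter on `a` that contains all final segments of `a` (equivalently, no
subset of `a` that is bounded below `μ`). -/
def ppSet (μ : Cardinal.{u}) : Set Cardinal.{u} :=
  {χ | ∃ a : Set Cardinal.{u},
    (∀ θ ∈ a, θ.IsRegular ∧ θ < μ) ∧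
    (∀ ν < μ, ∃ θ ∈ a, ν < θ) ∧
    #a = lift.{u + 1} μ.ord.cof ∧
    ∃ D : Ultrafilter a,
      (∀ ν < μ, ∀ᶠ θ : a in (D : Filter a), ν < (θ : Cardinal.{u})) ∧
      cofProd a D = lift.{u + 1} χ}

/-- The set of cofinalities defining the pseudopower is bounded, so that its supremum is genuine. -/
theorem bddAbove_ppSet (μ : Cardinal.{u}) : BddAbove (ppSet μ) := by
  refine ⟨μ ^ μ.ord.cof, ?_⟩
  rintro χ ⟨a, ha, -, hcard, D, -, hχ⟩
  rw [← lift_le.{u + 1}, ← hχ, lift_power, ← hcard]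
  refine (Order.cof_le_cardinalMk (UProd a D)).trans ?_
  have h : #(UProd a D) = Cardinal.prod fun θ : a => #(Set.Iio (θ : Cardinal.{u}).ord) :=
    Cardinal.mk_pi _
  rw [h, ← Cardinal.prod_const']
  refine Cardinal.prod_le_prod _ _ fun θ => ?_
  rw [Cardinal.mk_Iio_ordinal, card_ord, lift_le]
  exact (ha θ θ.2).2.le

/-- The pseudopower `pp(μ)` of a singular cardinal `μ`. -/
noncomputable def pp (μ : Cardinal.{u}) : Cardinal.{u} :=
  sSup (ppSet μ)

/-- The principle `(*)_κ`: there is a strictly increasing continuous sequence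
`(k i | i < cf κ)` of singular cardinals, cofinal in `κ`, such that for every limit ordinal
`i < cf κ` the set `pcf {(k j)⁺ | j < i}` has a maximum, and this maximum is `(k i)⁺`. Only the
values of `k` at ordinals `i < cf κ` matter. -/
def Star (κ : Cardinal.{u}) : Prop :=
  ∃ k : Ordinal.{u} → Cardinal.{u},
    (∀ i < κ.ord.cof.ord, IsSingular (k i) ∧ k i < κ) ∧
    (∀ i < κ.ord.cof.ord, ∀ j < i, k j < k i) ∧
    (∀ i < κ.ord.cof.ord, Order.IsSuccLimit i → IsLUB (k '' Set.Iio i) (k i)) ∧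
    (∀ ν < κ, ∃ i < κ.ord.cof.ord, ν < k i) ∧
    ∀ i < κ.ord.cof.ord, Order.IsSuccLimit i →
      IsGreatest (pcf ((fun j => Order.succ (k j)) '' Set.Iio i)) (Order.succ (k i))

/-- A set of ordinals below the cardinal `κ` contains a closed unbounded subset of `κ`. -/
def ContainsClub (κ : Cardinal.{u}) (S : Set (Set.Iio κ.ord)) : Prop :=
  ∃ C : Set (Set.Iio κ.ord), IsClub C ∧ C ⊆ S

end Pcf

/-! ### Suprema below regular cardinals, continuous recursions, closed points. -/

namespace Pcf
open Cardinal Ordinal Set Order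

section Sup
variable {c : Cardinal.{u}}

/-! Write `l = cf κ`. By `(*)`, at each limit `i` beyond some `i₀` the product of the `(k j)⁺`, `i₀
≤ j < i`, has a scale `f i`: a sequence of length `(k i)⁺` that is increasing and cofinal modulo
bounded sets. Since `pp (k i)` is always at least `(k i)⁺`, it suffices to refute that the set `S`
of limits with `pp (k i) = (k i)⁺` and the set `T` of limits with `pp (k i) > (k i)⁺` are both
stationary in `l`.

For `i ∈ T` choose `A i` and an ultrafilter `D i` with `cf (∏ A i / D i) > (k i)⁺`. Collect the
large members of all `A i`, together with the successors `(k j)⁺`, in one set `a` of at most `l`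
regular cardinals above `l⁺⁺⁺`. For `s ∈ S` the value of `pp` yields a scale `g s` in `∏ (a ∩ k s)`.
A function `G` in `∏ a` is thereby coded by the indices of bounds for it in the scales `g s`, and
these indices can be raised to a function `F` which at every limit `i` is a least upper bound of an
initial segment of `f i` (`ScaleSystem.exists_lub`). So `F` below `i` is determined, modulo a
bounded set, by one ordinal below `(k i)⁺`. A pressing-down argument on `S` then shows that, for
some `i ∈ T`, `G` is dominated below `k i` by one of `(k i)⁺` functions fixed in advance
(`ScaleSystem.exists_dominating`). A single `G` beating all these functions modulo every `D i` is a
contradiction.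

Passing from cofinalities of ultraproducts to scales modulo bounded sets is
`Progressive.exists_scale`, an iteration of length `l⁺`. Its key step is the stabilization result
`Obedient.exists_stable`, which rests on club guessing (`exists_club_guess`). -/

theorem iSup_lt_ord {ι : Type (u + 1)} (hc : c.IsRegular) (hι : #ι < lift.{u + 1} c)
    {f : ι → Ordinal.{u}} (hf : ∀ i, f i < c.ord) : ⨆ i, f i < c.ord := by
  refine Ordinal.lift_iSup_lt_of_lt_cof ?_ hf
  rw [← Ordinal.lift_cof, hc.cof_ord, Cardinal.lift_id'.{u, u + 1}]
  exact hι

theorem small_of_mk_le {ι : Type (u + 1)} (hι : #ι ≤ lift.{u + 1} c) : Small.{u} ι := by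
  obtain ⟨d, hd⟩ := mem_range_lift_of_le hι
  rw [← Cardinal.mk_out d, ← Cardinal.mk_uLift] at hd
  obtain ⟨e⟩ := Cardinal.eq.1 hd
  exact ⟨_, ⟨e.symm.trans Equiv.ulift⟩⟩

theorem mk_Iio_lt {i : Ordinal.{u}} (hi : i < c.ord) : #(Iio i) < lift.{u + 1} c := by
  rw [Cardinal.mk_Iio_ordinal, Cardinal.lift_lt]
  exact lt_ord.1 hi

theorem iSup_Iio_lt_ord (hc : c.IsRegular) {i : Ordinal.{u}} (hi : i.card < c)
    {f : Iio i → Ordinal.{u}} (hf : ∀ j, f j < c.ord) : ⨆ j, f j < c.ord :=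
  iSup_lt_ord hc (mk_Iio_lt (lt_ord.2 hi)) hf

theorem IsRegular.add_one_lt (hc : c.IsRegular) {x : Ordinal.{u}} (hx : x < c.ord) :
    x + 1 < c.ord :=
  (isSuccLimit_ord hc.1).succ_lt hx

end Sup

/-- The continuous sequence each of whose successor values exceeds the previous value as well
as a prescribed function of the history. -/
noncomputable def contSeq (step : Ordinal.{u} → (Ordinal.{u} → Ordinal.{u}) → Ordinal.{u}) :
    Ordinal.{u} → Ordinal.{u} :=
  WellFounded.fix (lt_wf : WellFounded ((· < ·) : Ordinal.{u} → Ordinal.{u} → Prop)) fun i rec =>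
    ⨆ j : Iio i, max (rec j j.2)
      (step j fun k => if h : k ≤ j then rec k (h.trans_lt j.2) else 0) + 1

section ContSeq
variable {step : Ordinal.{u} → (Ordinal.{u} → Ordinal.{u}) → Ordinal.{u}}

/-- The history of a sequence up to and including stage `j`. -/
noncomputable def hist (x : Ordinal.{u} → Ordinal.{u}) (j k : Ordinal.{u}) : Ordinal.{u} :=
  if k ≤ j then x k else 0

theorem hist_of_le {x : Ordinal.{u} → Ordinal.{u}} {j k : Ordinal.{u}} (h : k ≤ j) :
    hist x j k = x k := if_pos h

theorem contSeq_eq (i : Ordinal.{u}) : contSeq step i = ⨆ j : Iio i,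
    max (contSeq step j) (step j (hist (contSeq step) j)) + 1 := by
  conv_lhs => rw [contSeq, WellFounded.fix_eq]
  rfl

theorem contSeq_lt {i j : Ordinal.{u}} (h : j < i) : contSeq step j < contSeq step i := by
  rw [contSeq_eq i, Ordinal.lt_iSup_add_one_iff]
  exact ⟨⟨j, h⟩, le_max_left _ _⟩

theorem step_lt_contSeq {i j : Ordinal.{u}} (h : j < i) :
    step j (hist (contSeq step) j) < contSeq step i := by
  rw [contSeq_eq i, Ordinal.lt_iSup_add_one_iff]
  exact ⟨⟨j, h⟩, le_max_right _ _⟩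

theorem contSeq_le_succ {j : Ordinal.{u}} {i : Ordinal.{u}} (h : j < i) :
    max (contSeq step j) (step j (hist (contSeq step) j)) + 1 ≤ contSeq step i := by
  rw [add_one_le_iff]
  exact max_lt (contSeq_lt h) (step_lt_contSeq h)

/-- Each value is a supremum of successors computed from earlier stages alone, so continuity at
limits is automatic. -/
theorem contSeq_isNormal : IsNormal (contSeq step) := by
  rw [isNormal_iff]
  refine ⟨fun j i h => contSeq_lt h, fun i hi a ha => ?_⟩
  rw [contSeq_eq]
  refine Ordinal.iSup_le fun j => ?_
  exact (contSeq_le_succ (lt_succ j.1)).trans (ha _ (hi.succ_lt j.2))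

theorem contSeq_lt_ord {c : Cardinal.{u}} (hc : c.IsRegular)
    (hstep : ∀ i < c.ord, ∀ x : Ordinal.{u} → Ordinal.{u}, (∀ j, x j < c.ord) →
      step i x < c.ord) {i : Ordinal.{u}} (hi : i < c.ord) : contSeq step i < c.ord := by
  induction i using WellFoundedLT.induction with
  | ind i ih =>
    rw [contSeq_eq]
    refine iSup_Iio_lt_ord hc (lt_ord.1 hi) fun j => IsRegular.add_one_lt hc (max_lt ?_ ?_)
    · exact ih j j.2 (lt_trans j.2 hi)
    · refine hstep _ (lt_trans j.2 hi) _ fun k => ?_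
      unfold hist
      split_ifs with h
      · exact ih k (h.trans_lt j.2) ((h.trans_lt j.2).trans hi)
      · exact hc.ord_pos

end ContSeq

/-- `β` is a positive ordinal closed under `m`. -/
def Closed (m : Ordinal.{u} → Ordinal.{u}) (β : Ordinal.{u}) : Prop :=
  β ≠ 0 ∧ ∀ γ < β, m γ < β

theorem Closed.mono {m n : Ordinal.{u} → Ordinal.{u}} {β : Ordinal.{u}} (h : Closed n β)
    (hmn : ∀ γ < β, m γ ≤ n γ) : Closed m β :=
  ⟨h.1, fun γ hγ => (hmn γ hγ).trans_lt (h.2 γ hγ)⟩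

theorem Closed.isSuccLimit {m : Ordinal.{u} → Ordinal.{u}} {β : Ordinal.{u}} (h : Closed m β)
    (hm : ∀ γ < β, γ < m γ) : IsSuccLimit β := by
  refine Ordinal.isSuccLimit_iff.2 ⟨h.1, ?_⟩
  refine isSuccPrelimit_of_succ_lt fun γ hγ => ?_
  exact (succ_le_of_lt (hm γ hγ)).trans_lt (h.2 γ hγ)

/-- Iterate `ω` times, each time passing the `m`-values of everything below the current point; the
limit stays below `c` because `c` is regular and uncountable. -/
theorem exists_closed {c : Cardinal.{u}} (hc : c.IsRegular) (hc' : ℵ₀ < c)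
    {m : Ordinal.{u} → Ordinal.{u}} (hm : ∀ i < c.ord, m i < c.ord) {x : Ordinal.{u}}
    (hx : x < c.ord) : ∃ β < c.ord, x < β ∧ Closed m β := by
  set step : Ordinal.{u} → (Ordinal.{u} → Ordinal.{u}) → Ordinal.{u} :=
    fun j h => max x (⨆ γ : Iio (h j), m γ) with hstep
  have hω : ω < c.ord := by rwa [← ord_aleph0, ord_lt_ord]
  have hlim : IsSuccLimit (ω : Ordinal.{u}) := isSuccLimit_omega0
  refine ⟨contSeq step ω, contSeq_lt_ord hc (fun i _ y hy => ?_) hω, ?_, ?_, ?_⟩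
  · exact max_lt hx (iSup_Iio_lt_ord hc (lt_ord.1 (hy i)) fun γ => hm _ (lt_trans γ.2 (hy i)))
  · exact (le_max_left _ _).trans_lt (step_lt_contSeq (step := step) (omega0_pos))
  · exact ((zero_le).trans_lt (contSeq_lt (step := step) omega0_pos)).ne'
  · intro γ hγ
    obtain ⟨n, hn, hγn⟩ := (contSeq_isNormal.lt_iff_exists_lt hlim).1 hγ
    refine lt_of_le_of_lt ?_ (step_lt_contSeq (step := step) hn)
    refine le_trans ?_ (le_max_right _ _)
    rw [hist_of_le le_rfl]
    exact Ordinal.le_iSup (fun γ : Iio (contSeq step n) => m γ) ⟨γ, hγn⟩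

/-- A function from an unbounded set of ordinals below a cofinality into a set of smaller size is
constant on an unbounded set. -/
theorem exists_const_unbounded {α : Ordinal.{u}} {X : Type (u + 1)}
    (hX : #X < lift.{u + 1} α.cof) {s : Set Ordinal.{u}}
    (hs : ∀ x < α, ∃ y ∈ s, x < y ∧ y < α) (f : Ordinal.{u} → X) :
    ∃ a, ∀ x < α, ∃ y ∈ s, x < y ∧ y < α ∧ f y = a := by
  by_contra! h
  choose x hx hx' using h
  -- `x a` bounds the places in `s` where the value `a` is taken. There are fewer values than `cf
  -- α`, so some point of `s` lies above all these bounds and no value is left for it.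
  have hlt : ⨆ a, x a < α := by
    refine Ordinal.lift_iSup_lt_of_lt_cof ?_ hx
    rwa [← Ordinal.lift_cof, Cardinal.lift_id'.{u, u + 1}]
  have : Small.{u} X := small_of_mk_le hX.le
  obtain ⟨y, hy, hy', hyα⟩ := hs _ hlt
  exact hx' (f y) y hy ((Ordinal.le_iSup x (f y)).trans_lt hy') hyα rfl

end Pcf
-- Club guessing.
namespace Pcf
open Cardinal Ordinal Set Order

theorem exists_cofinal_set (α : Ordinal.{u}) : ∃ c : Set Ordinal.{u}, c ⊆ Iio α ∧
    (∀ γ < α, ∃ x ∈ c, γ ≤ x) ∧ #c = lift.{u + 1} α.cof := by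
  obtain ⟨s, hs, hs'⟩ := exists_cof_eq (Iio α)
  refine ⟨Subtype.val '' s, ?_, fun γ hγ => ?_, ?_⟩
  · rintro _ ⟨x, -, rfl⟩
    exact x.2
  · obtain ⟨x, hx, hx'⟩ := hs ⟨γ, hγ⟩
    exact ⟨x, ⟨x, hx, rfl⟩, hx'⟩
  · rw [mk_image_eq Subtype.val_injective, hs', cof_Iio, ← lift_cof]

theorem Closed.sSup {m : Ordinal.{u} → Ordinal.{u}} {s : Set Ordinal.{u}} (hs : s.Nonempty)
    (hb : BddAbove s) (h : ∀ x ∈ s, Closed m x) : Closed m (sSup s) := by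
  obtain ⟨x, hx⟩ := hs
  refine ⟨fun h0 => (h x hx).1 ?_, fun γ hγ => ?_⟩
  · have := le_csSup hb hx
    rw [h0] at this
    exact nonpos_iff_eq_zero.1 this
  · obtain ⟨y, hy, hγy⟩ := exists_lt_of_lt_csSup ⟨x, hx⟩ hγ
    exact ((h y hy).2 γ hγy).trans_le (le_csSup hb hy)

/-- The largest ordinal `≤ β` closed under `m`, or `0`. -/
noncomputable def lastClosed (m : Ordinal.{u} → Ordinal.{u}) (β : Ordinal.{u}) : Ordinal.{u} :=
  sSup ({e | Closed m e} ∩ Iic β)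

section LastClosed
variable {m n : Ordinal.{u} → Ordinal.{u}} {β e : Ordinal.{u}}

theorem bddAbove_closed : BddAbove ({e | Closed m e} ∩ Iic β) := ⟨β, fun _ h => h.2⟩

theorem lastClosed_le : lastClosed m β ≤ β := csSup_le' fun _ h => h.2

theorem le_lastClosed (h : Closed m e) (he : e ≤ β) : e ≤ lastClosed m β :=
  le_csSup bddAbove_closed ⟨h, he⟩

theorem closed_lastClosed (h : lastClosed m β ≠ 0) : Closed m (lastClosed m β) := by
  refine Closed.sSup ?_ bddAbove_closed fun x hx => hx.1
  by_contra h'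
  rw [not_nonempty_iff_eq_empty] at h'
  exact h (by rw [lastClosed, h', csSup_empty]; rfl)

theorem lastClosed_anti (h : ∀ γ, m γ ≤ n γ) : lastClosed n β ≤ lastClosed m β :=
  csSup_le_csSup' bddAbove_closed fun _ hx => ⟨hx.1.mono fun γ _ => h γ, hx.2⟩

end LastClosed

/-- Club guessing at the points of cofinality `ρ` below `ρ⁺⁺`. -/
theorem exists_club_guess {ρ : Cardinal.{u}} (hρ : ρ.IsRegular) :
    ∃ C : Ordinal.{u} → Set Ordinal.{u}, (∀ α, ∀ x ∈ C α, x < α) ∧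
      ∀ m : Ordinal.{u} → Ordinal.{u},
        (∀ i < (succ (succ ρ)).ord, m i < (succ (succ ρ)).ord) →
        ∃ α < (succ (succ ρ)).ord, α.cof = ρ ∧ (∀ γ < α, ∃ x ∈ C α, γ < x) ∧
          ∀ x ∈ C α, Closed m x := by
  have hσ : (succ ρ).IsRegular := isRegular_succ hρ.1
  have hτ : (succ (succ ρ)).IsRegular := isRegular_succ hσ.1
  set τ := succ (succ ρ) with hτdef
  have hστ : succ ρ < τ := lt_succ _
  have hρτ : ρ < τ := (lt_succ ρ).trans hστ
  choose c hcα hccof hcard using exists_cofinal_set.{u}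
  -- Candidate guesses: push each point of a fixed cofinal set `c α` down to the last `f`-closed
  -- point. The value `0` is excluded because it is the default when there is no such point.
  set G : (Ordinal.{u} → Ordinal.{u}) → Ordinal.{u} → Set Ordinal.{u} :=
    fun f α => {x | x < α ∧ x ≠ 0 ∧ ∃ β ∈ c α, x = lastClosed f β} with hG
  by_contra! hcon
  have hbad : ∀ f : Ordinal.{u} → Ordinal.{u}, ∃ m : Ordinal.{u} → Ordinal.{u},
      (∀ i < τ.ord, m i < τ.ord) ∧ ∀ α < τ.ord, α.cof = ρ → (∀ γ < α, ∃ x ∈ G f α, γ < x) →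
        ∃ x ∈ G f α, ¬ Closed m x := by
    intro f
    obtain ⟨m, hm, h⟩ := hcon (G f) fun α x hx => hx.1
    exact ⟨m, hm, h⟩
  choose bad hbadlt hbad using hbad
  -- If every candidate fails, the counterexamples are absorbed one after another, giving functions
  -- that increase pointwise along `ρ⁺` stages.
  let f : Ordinal.{u} → Ordinal.{u} → Ordinal.{u} :=
    WellFounded.fix (lt_wf : WellFounded ((· < ·) : Ordinal.{u} → Ordinal.{u} → Prop))
      fun i rec γ => ⨆ j : Iio i, max (rec j j.2 γ) (bad (rec j j.2) γ)
  have hf : ∀ i γ, f i γ = ⨆ j : Iio i, max (f j γ) (bad (f j) γ) := by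
    intro i γ
    conv_lhs => rw [show f i = _ from WellFounded.fix_eq _ _ i]
  have hle : ∀ i j, j < i → ∀ γ, max (f j γ) (bad (f j) γ) ≤ f i γ := by
    intro i j hij γ
    rw [hf i]
    exact Ordinal.le_iSup (fun j : Iio i => max (f j γ) (bad (f j) γ)) ⟨j, hij⟩
  have hmono : ∀ i j, j ≤ i → ∀ γ, f j γ ≤ f i γ := by
    intro i j hij γ
    rcases hij.eq_or_lt with rfl | h
    · rfl
    · exact (le_max_left _ _).trans (hle i j h γ)
  have hflt : ∀ i, i.card < τ → ∀ γ < τ.ord, f i γ < τ.ord := by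
    intro i
    induction i using WellFoundedLT.induction with
    | ind i ih =>
      intro hi γ hγ
      rw [hf i]
      refine iSup_Iio_lt_ord hτ hi fun j => max_lt ?_ (hbadlt _ _ hγ)
      exact ih j j.2 ((card_le_card (le_of_lt j.2)).trans_lt hi) γ hγ
  set F := f (succ ρ).ord with hF
  have hFlt : ∀ γ < τ.ord, F γ < τ.ord := hflt _ (by rwa [card_ord])
  have hnext : ∀ x : Ordinal.{u}, ∃ y, x < τ.ord → y < τ.ord ∧ x < y ∧ Closed F y := by
    intro x
    by_cases hx : x < τ.ord
    · obtain ⟨y, h⟩ := exists_closed hτ (hρ.1.trans_lt hρτ) hFlt hx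
      exact ⟨y, fun _ => h⟩
    · exact ⟨0, fun h => (hx h).elim⟩
  choose next hnext using hnext
  set step : Ordinal.{u} → (Ordinal.{u} → Ordinal.{u}) → Ordinal.{u} := fun j h => next (h j)
  have hlt : ∀ i < τ.ord, contSeq step i < τ.ord := fun i hi =>
    contSeq_lt_ord hτ (fun j _ x hx => (hnext _ (hx j)).1) hi
  have hρlim : IsSuccLimit ρ.ord := isSuccLimit_ord hρ.1
  have hρord : ρ.ord < τ.ord := ord_lt_ord.2 hρτ
  -- `α` is a limit of `ρ` many points closed under `F`, hence under every earlier `f i`; this makes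
  -- the guess at `α` unbounded at each stage.
  set α := contSeq step ρ.ord with hα
  have hατ : α < τ.ord := hlt _ hρord
  have hαcof : α.cof = ρ := by
    rw [hα, cof_map_of_isNormal contSeq_isNormal hρlim, hρ.cof_ord]
  have hclosed : ∀ γ < α, ∃ e < α, γ < e ∧ Closed F e := by
    intro γ hγ
    obtain ⟨j, hj, hγj⟩ := (contSeq_isNormal.lt_iff_exists_lt hρlim).1 hγ
    have h := hnext _ (hlt j (hj.trans hρord))
    have h' := step_lt_contSeq (step := step) hj
    simp only [step, hist_of_le le_rfl] at h'
    exact ⟨_, h', hγj.trans h.2.1, h.2.2⟩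
  -- Larger functions have fewer closed points, so the last closed point only decreases with the
  -- stage and must become constant.
  have hstab : ∀ β : Ordinal.{u}, ∃ i < (succ ρ).ord, ∀ j < (succ ρ).ord, i ≤ j →
      lastClosed (f j) β = lastClosed (f i) β := by
    intro β
    obtain ⟨-, ⟨i, hi, rfl⟩, hmin⟩ := WellFounded.has_min (wellFounded_lt (α := Ordinal.{u}))
      ((fun i => lastClosed (f i) β) '' Iio (succ ρ).ord) ⟨_, 0, hσ.ord_pos, rfl⟩
    refine ⟨i, hi, fun j hj hij => le_antisymm (lastClosed_anti (hmono j i hij)) ?_⟩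
    exact not_lt.1 (hmin _ ⟨j, hj, rfl⟩)
  choose st hst hstab using hstab
  have hcard' : #(c α) < lift.{u + 1} (succ ρ) := by
    rw [hcard, hαcof, Cardinal.lift_lt]
    exact lt_succ ρ
  have : Small.{u} (c α) := small_of_mk_le hcard'.le
  -- As `c α` has only `ρ` points, one stage `i < ρ⁺` works for all of them. The guess at stage `i`
  -- then consists of points closed under `f (i + 1)`, hence under the counterexample `bad (f i)`.
  set i := ⨆ β : c α, st β with hi
  have hiσ : i < (succ ρ).ord := iSup_lt_ord hσ hcard' fun β => hst β
  have hi1 : i + 1 < (succ ρ).ord := IsRegular.add_one_lt hσ hiσ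
  obtain ⟨x, ⟨hxα, hx0, β, hβ, hxβ⟩, hx⟩ := hbad (f i) α hατ hαcof fun γ hγ => by
    obtain ⟨e, heα, hγe, he⟩ := hclosed γ hγ
    obtain ⟨β, hβ, heβ⟩ := hccof α e heα
    have hel : e ≤ lastClosed (f i) β :=
      le_lastClosed (he.mono fun γ _ => hmono _ _ hiσ.le γ) heβ
    exact ⟨_, ⟨lastClosed_le.trans_lt (hcα α hβ), (zero_le.trans_lt (hγe.trans_le hel)).ne',
      β, hβ, rfl⟩, hγe.trans_le hel⟩
  have hsti : st β ≤ i := Ordinal.le_iSup (fun β : c α => st β) ⟨β, hβ⟩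
  have hxβ' : x = lastClosed (f (i + 1)) β := by
    rw [hxβ, hstab β i hiσ hsti, hstab β _ hi1 (hsti.trans (lt_succ i).le)]
  refine hx ?_
  rw [hxβ'] at hx0 ⊢
  exact (closed_lastClosed hx0).mono fun γ _ =>
    (le_max_right _ _).trans (hle (i + 1) i (lt_succ i) γ)

end Pcf
-- Products of regular cardinals modulo bounded sets.
namespace Pcf
open Cardinal Ordinal Set Order

/-- `b` is a set of at most `l` regular cardinals above `l`, unbounded in `μ`. -/
structure Progressive (b : Set Cardinal.{u}) (μ l : Cardinal.{u}) : Prop where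
  reg : ∀ θ ∈ b, θ.IsRegular
  lt : ∀ θ ∈ b, θ < μ
  unb : ∀ ν < μ, ∃ θ ∈ b, ν < θ
  card : #b ≤ Cardinal.lift.{u + 1} l
  gt : ∀ θ ∈ b, l < θ
  inf : ℵ₀ ≤ l
  lt_sup : l < μ

/-- The function `f` belongs to the product `∏ b`. -/
def Below (b : Set Cardinal.{u}) (f : Cardinal.{u} → Ordinal.{u}) : Prop :=
  ∀ θ ∈ b, f θ < θ.ord

/-- `f ≤ g` on `b`, except on a set that is bounded below `μ`. -/
def BLE (b : Set Cardinal.{u}) (μ : Cardinal.{u}) (f g : Cardinal.{u} → Ordinal.{u}) : Prop :=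
  ∃ ν < μ, ∀ θ ∈ b, ν < θ → f θ ≤ g θ

/-- `f < g` on `b`, except on a set that is bounded below `μ`. -/
def BLT (b : Set Cardinal.{u}) (μ : Cardinal.{u}) (f g : Cardinal.{u} → Ordinal.{u}) : Prop :=
  ∃ ν < μ, ∀ θ ∈ b, ν < θ → f θ < g θ

section
variable {b : Set Cardinal.{u}} {μ l : Cardinal.{u}} {f g h : Cardinal.{u} → Ordinal.{u}}

namespace Progressive
variable (P : Progressive b μ l)
include P

theorem small : Small.{u} b := small_of_mk_le P.card

theorem reg_succ : (succ μ).IsRegular := isRegular_succ (P.inf.trans P.lt_sup.le)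

theorem below_zero : Below b fun _ => 0 := fun θ hθ => (P.reg θ hθ).ord_pos

theorem iSup_lt {ι : Type (u + 1)} (hι : #ι ≤ lift.{u + 1} l) {f : ι → Ordinal.{u}}
    {θ : Cardinal.{u}} (hθ : θ ∈ b) (hf : ∀ i, f i < θ.ord) : ⨆ i, f i < θ.ord :=
  iSup_lt_ord (P.reg θ hθ) (hι.trans_lt (Cardinal.lift_lt.2 (P.gt θ hθ))) hf

/-- Diagonalize: at `θ` take the supremum only over indices below some `p ∈ b` with `p < θ`. These
are fewer than `θ`, and each fixed index is taken into account from some `p` on. -/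
theorem exists_bound_of_lt {h : Ordinal.{u} → Cardinal.{u} → Ordinal.{u}}
    (hh : ∀ ξ < μ.ord, Below b (h ξ)) : ∃ g, Below b g ∧ ∀ ξ < μ.ord, BLT b μ (h ξ) g := by
  have := P.small
  have hsm : ∀ θ : Cardinal.{u}, Small.{u} (b ∩ Iio θ : Set Cardinal.{u}) := fun θ =>
    small_of_mk_le ((mk_le_mk_of_subset inter_subset_left).trans P.card)
  refine ⟨fun θ => ⨆ p : (b ∩ Iio θ : Set Cardinal.{u}), ⨆ ξ : Iio (p : Cardinal.{u}).ord,
    h ξ θ + 1, fun θ hθ => ?_, fun ξ hξ => ?_⟩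
  · refine P.iSup_lt ((mk_le_mk_of_subset inter_subset_left).trans P.card) hθ fun p => ?_
    refine iSup_Iio_lt_ord (P.reg θ hθ) (by rw [card_ord]; exact p.2.2) fun ξ => ?_
    exact IsRegular.add_one_lt (P.reg θ hθ)
      (hh ξ (lt_trans ξ.2 (ord_lt_ord.2 (P.lt _ p.2.1))) θ hθ)
  · obtain ⟨p, hp, hξp⟩ := P.unb _ (lt_ord.1 hξ)
    refine ⟨p, P.lt p hp, fun θ hθ hpθ => ?_⟩
    rw [← add_one_le_iff]
    refine le_trans ?_ (Ordinal.le_iSup (fun p : (b ∩ Iio θ : Set Cardinal.{u}) =>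
      ⨆ ξ : Iio (p : Cardinal.{u}).ord, h ξ θ + 1) ⟨p, hp, hpθ⟩)
    exact Ordinal.le_iSup (fun ξ : Iio p.ord => h ξ θ + 1) ⟨ξ, lt_ord.2 hξp⟩

/-- Any `μ` many functions in the product are bounded modulo bounded sets. -/
theorem exists_bound {ζ : Ordinal.{u}} (hζ : ζ < (succ μ).ord)
    {h : Ordinal.{u} → Cardinal.{u} → Ordinal.{u}}
    (hh : ∀ ξ < ζ, Below b (h ξ)) : ∃ g, Below b g ∧ ∀ ξ < ζ, BLT b μ (h ξ) g := by
  have hle : #(Iio ζ) ≤ #(Iio μ.ord) := by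
    rw [Cardinal.mk_Iio_ordinal, Cardinal.mk_Iio_ordinal, Cardinal.lift_le, card_ord]
    exact lt_succ_iff.1 (lt_ord.1 hζ)
  obtain ⟨φ⟩ := hle
  classical
  -- The family is reindexed by `μ` along the injection `φ`, with the zero function at indices
  -- outside the range.
  obtain ⟨g, hg, hg'⟩ := P.exists_bound_of_lt (h := fun ξ =>
    if H : ∃ η : Iio ζ, (φ η : Ordinal.{u}) = ξ then h H.choose else fun _ => 0) (by
      intro ξ _
      split_ifs with H
      · exact hh _ H.choose.2
      · exact P.below_zero)
  refine ⟨g, hg, fun ξ hξ => ?_⟩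
  have H : ∃ η : Iio ζ, (φ η : Ordinal.{u}) = φ ⟨ξ, hξ⟩ := ⟨_, rfl⟩
  have hg'' := hg' _ (φ ⟨ξ, hξ⟩).2
  rw [dif_pos H] at hg''
  have : H.choose = ⟨ξ, hξ⟩ := φ.injective (Subtype.ext H.choose_spec)
  rwa [this] at hg''

/-- There are `μ⁺`-sequences in the product that are increasing modulo bounded sets, dominate a
given sequence, and dominate given short subsequences everywhere. -/
theorem exists_obedient {τ : Cardinal.{u}} (hτ : ∀ θ ∈ b, τ < θ)
    {r : Ordinal.{u} → Cardinal.{u} → Ordinal.{u}} (hr : ∀ ξ < (succ μ).ord, Below b (r ξ))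
    (e : Ordinal.{u} → Ordinal.{u} → Ordinal.{u}) :
    ∃ f : Ordinal.{u} → Cardinal.{u} → Ordinal.{u}, ∀ ξ < (succ μ).ord, Below b (f ξ) ∧
      (∀ θ ∈ b, r ξ θ ≤ f ξ θ) ∧ (∀ η < ξ, BLT b μ (f η) (f ξ)) ∧
      ∀ i < τ.ord, e ξ i < ξ → ∀ θ ∈ b, f (e ξ i) θ ≤ f ξ θ := by
  classical
  have key : ∀ ξ (p : Ordinal.{u} → Cardinal.{u} → Ordinal.{u}),
      ∃ v : Cardinal.{u} → Ordinal.{u}, ξ < (succ μ).ord → (∀ η < ξ, Below b (p η)) →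
        Below b v ∧ (∀ θ ∈ b, r ξ θ ≤ v θ) ∧ (∀ η < ξ, BLT b μ (p η) v) ∧
        ∀ i < τ.ord, e ξ i < ξ → ∀ θ ∈ b, p (e ξ i) θ ≤ v θ := by
    intro ξ p
    by_cases hξ : ξ < (succ μ).ord ∧ ∀ η < ξ, Below b (p η)
    · obtain ⟨g, hg, hg'⟩ := P.exists_bound hξ.1 hξ.2
      -- The supremum over the `τ` prescribed indices remains in the product because `τ < θ`.
      refine ⟨fun θ => max (r ξ θ) (max (g θ)
        (⨆ i : Iio τ.ord, if e ξ i < ξ then p (e ξ i) θ else 0)), fun _ _ => ⟨?_, ?_, ?_, ?_⟩⟩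
      · intro θ hθ
        refine max_lt (hr ξ hξ.1 θ hθ) (max_lt (hg θ hθ) ?_)
        refine iSup_Iio_lt_ord (P.reg θ hθ) (by rw [card_ord]; exact hτ θ hθ) fun i => ?_
        split_ifs with hi
        · exact hξ.2 _ hi θ hθ
        · exact (P.reg θ hθ).ord_pos
      · exact fun θ _ => le_max_left _ _
      · intro η hη
        obtain ⟨ν, hν, h⟩ := hg' η hη
        exact ⟨ν, hν, fun θ hθ hνθ => (h θ hθ hνθ).trans_le
          ((le_max_left _ _).trans (le_max_right _ _))⟩
      · intro i hi hei θ hθ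
        refine le_trans ?_ ((le_max_right _ _).trans (le_max_right _ _))
        refine le_trans ?_ (Ordinal.le_iSup (fun i : Iio τ.ord =>
          if e ξ i < ξ then p (e ξ i) θ else 0) ⟨i, hi⟩)
        simp only [if_pos hei, le_rfl]
    · exact ⟨fun _ => 0, fun h h' => (hξ ⟨h, h'⟩).elim⟩
  choose V hV using key
  let f : Ordinal.{u} → Cardinal.{u} → Ordinal.{u} :=
    WellFounded.fix (lt_wf : WellFounded ((· < ·) : Ordinal.{u} → Ordinal.{u} → Prop))
      fun ξ rec => V ξ fun η => if h : η < ξ then rec η h else fun _ => 0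
  have hf : ∀ ξ, f ξ = V ξ fun η => if η < ξ then f η else fun _ => 0 := by
    intro ξ
    conv_lhs => rw [show f ξ = _ from WellFounded.fix_eq _ _ ξ]
    rfl
  refine ⟨f, fun ξ => ?_⟩
  induction ξ using WellFoundedLT.induction with
  | ind ξ ih =>
    intro hξ
    obtain ⟨h1, h2, h3, h4⟩ := hV ξ (fun η => if η < ξ then f η else fun _ => 0) hξ (by
      intro η hη
      simp only [if_pos hη]
      exact (ih η hη (hη.trans hξ)).1)
    rw [← hf ξ] at h1 h2 h3 h4
    refine ⟨h1, h2, fun η hη => ?_, fun i hi hei => ?_⟩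
    · have := h3 η hη
      simpa only [if_pos hη] using this
    · have := h4 i hi hei
      simpa only [if_pos hei] using this

end Progressive
end

/-- An ordinal of cofinality `τ` is the limit of a continuous sequence of length `τ`. -/
theorem exists_continuous_cofinal {τ : Cardinal.{u}} (hτ : τ.IsRegular) {δ : Ordinal.{u}}
    (hδ : δ.cof = τ) : ∃ e : Ordinal.{u} → Ordinal.{u}, Monotone e ∧
      (∀ i < τ.ord, e i < δ) ∧ (∀ x < δ, ∃ i < τ.ord, x < e i) ∧
      ∀ i, IsSuccLimit i → ∀ x < e i, ∃ j < i, x < e j := by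
  classical
  obtain ⟨f, hf⟩ := exists_isFundamentalSeq (o := δ) (a := τ.ord) (by rw [hδ])
  have hlim : IsSuccLimit δ := by
    rw [← one_lt_cof_iff, hδ]
    exact one_lt_aleph0.trans_le hτ.1
  have hlt : ∀ i j : Ordinal.{u}, j < i → ∀ hj : j < τ.ord, (f ⟨j, hj⟩ : Ordinal.{u}) <
      ⨆ j : Iio i, if h : (j : Ordinal.{u}) < τ.ord then (f ⟨j, h⟩ : Ordinal.{u}) + 1 else 0 := by
    intro i j hji hj
    rw [← add_one_le_iff]
    refine le_trans ?_ (Ordinal.le_iSup (fun j : Iio i =>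
      if h : (j : Ordinal.{u}) < τ.ord then (f ⟨j, h⟩ : Ordinal.{u}) + 1 else 0) ⟨j, hji⟩)
    simp only [dif_pos hj, le_rfl]
  -- Taking suprema of the earlier values of a fundamental sequence, plus one, makes the sequence
  -- continuous.
  refine ⟨fun i => ⨆ j : Iio i, if h : (j : Ordinal.{u}) < τ.ord then
    (f ⟨j, h⟩ : Ordinal.{u}) + 1 else 0, fun i k hik => ?_, fun i hi => ?_, fun x hx => ?_,
    fun i hi x hx => ?_⟩
  · refine Ordinal.iSup_le fun j => ?_
    exact Ordinal.le_iSup (fun j : Iio k => if h : (j : Ordinal.{u}) < τ.ord then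
      (f ⟨j, h⟩ : Ordinal.{u}) + 1 else 0) ⟨j, lt_of_lt_of_le j.2 hik⟩
  · refine Ordinal.lift_iSup_lt_of_lt_cof ?_ fun j => ?_
    · rw [← Ordinal.lift_cof, hδ, Cardinal.lift_id'.{u, u + 1}]
      exact mk_Iio_lt hi
    · have hj : (j : Ordinal.{u}) < τ.ord := lt_trans j.2 hi
      simp only [dif_pos hj]
      exact hlim.succ_lt (f _).2
  · obtain ⟨_, ⟨i, rfl⟩, hxi⟩ := hf.isCofinal_range ⟨x, hx⟩
    exact ⟨i + 1, IsRegular.add_one_lt hτ i.2,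
      lt_of_le_of_lt hxi (hlt _ _ (lt_add_one _) i.2)⟩
  · obtain ⟨j, hj⟩ := Ordinal.lt_iSup_iff.1 hx
    refine ⟨j + 1, hi.succ_lt j.2, ?_⟩
    split_ifs at hj with hjτ
    · exact (lt_add_one_iff.1 hj).trans_lt (hlt _ _ (lt_add_one _) hjτ)
    · exact absurd hj not_lt_zero

end Pcf
-- Obedient sequences and stabilization.
namespace Pcf
open Cardinal Ordinal Set Order

/-- The sequence `f` of length `μ⁺` is increasing in `∏ b` modulo bounded sets, and each `f ξ`
dominates everywhere the functions with indices `e ξ i < ξ`, for `i < τ`. -/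
structure Obedient (b : Set Cardinal.{u}) (μ τ : Cardinal.{u})
    (e : Ordinal.{u} → Ordinal.{u} → Ordinal.{u})
    (f : Ordinal.{u} → Cardinal.{u} → Ordinal.{u}) : Prop where
  below : ∀ ξ < (succ μ).ord, Below b (f ξ)
  blt : ∀ ξ < (succ μ).ord, ∀ η < ξ, BLT b μ (f η) (f ξ)
  le : ∀ ξ < (succ μ).ord, ∀ i < τ.ord, e ξ i < ξ → ∀ θ ∈ b, f (e ξ i) θ ≤ f ξ θ

/-- `e` selects a continuous cofinal sequence of length `τ` at every ordinal of cofinality `τ`. -/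
def IsLadder (τ : Cardinal.{u}) (e : Ordinal.{u} → Ordinal.{u} → Ordinal.{u}) : Prop :=
  ∀ δ : Ordinal.{u}, δ.cof = τ → Monotone (e δ) ∧
      (∀ i < τ.ord, e δ i < δ) ∧ (∀ x < δ, ∃ i < τ.ord, x < e δ i) ∧
      ∀ i, IsSuccLimit i → ∀ x < e δ i, ∃ j < i, x < e δ j

theorem exists_isLadder {τ : Cardinal.{u}} (hτ : τ.IsRegular) : ∃ e, IsLadder τ e := by
  have : ∀ δ : Ordinal.{u}, ∃ e : Ordinal.{u} → Ordinal.{u}, δ.cof = τ → Monotone e ∧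
      (∀ i < τ.ord, e i < δ) ∧ (∀ x < δ, ∃ i < τ.ord, x < e i) ∧
      ∀ i, IsSuccLimit i → ∀ x < e i, ∃ j < i, x < e j := by
    intro δ
    by_cases hδ : δ.cof = τ
    · obtain ⟨e, he⟩ := exists_continuous_cofinal hτ hδ
      exact ⟨e, fun _ => he⟩
    · exact ⟨id, fun h => (hδ h).elim⟩
  choose e he using this
  exact ⟨e, he⟩

/-- Two continuous sequences cofinal in the same ordinal interleave, so they agree at every index
closed under the interleaving function `m`. -/
theorem contSeq_eq_ladder {τ : Cardinal.{u}} {e : Ordinal.{u} → Ordinal.{u} → Ordinal.{u}}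
    (he : IsLadder τ e) (hτ : τ.IsRegular)
    {x : Ordinal.{u} → Ordinal.{u}} (hx : IsNormal x) :
    ∃ m : Ordinal.{u} → Ordinal.{u}, (∀ i < τ.ord, m i < τ.ord) ∧
      ∀ i < τ.ord, Closed m i → x i = e (x τ.ord) i := by
  have hlim : IsSuccLimit τ.ord := isSuccLimit_ord hτ.1
  obtain ⟨he1, he2, he3, he4⟩ := he (x τ.ord) (by
    rw [cof_map_of_isNormal hx hlim, hτ.cof_ord])
  set e' := e (x τ.ord)
  have hm : ∀ j, ∃ k, j < τ.ord → k < τ.ord ∧ x j < e' k ∧ e' j < x k ∧ j < k := by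
    intro j
    by_cases hj : j < τ.ord
    · obtain ⟨k, hk, hk'⟩ := he3 _ (hx.strictMono hj)
      obtain ⟨n, hn, hn'⟩ := (hx.lt_iff_exists_lt hlim).1 (he2 j hj)
      refine ⟨max (max k n) (j + 1), fun _ => ⟨?_, ?_, ?_, ?_⟩⟩
      · exact max_lt (max_lt hk hn) (IsRegular.add_one_lt hτ hj)
      · exact hk'.trans_le (he1 ((le_max_left _ _).trans (le_max_left _ _)))
      · exact hn'.trans_le (hx.monotone ((le_max_right _ _).trans (le_max_left _ _)))
      · exact (lt_add_one j).trans_le (le_max_right _ _)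
    · exact ⟨0, fun h => (hj h).elim⟩
  choose m hm using hm
  refine ⟨m, fun i hi => (hm i hi).1, fun i hi hmi => ?_⟩
  have hilim : IsSuccLimit i := hmi.isSuccLimit fun γ hγ => (hm γ (hγ.trans hi)).2.2.2
  refine le_antisymm ((hx.le_iff_forall_le hilim).2 fun j hj => ?_) (not_lt.1 fun hlt => ?_)
  · exact (hm j (hj.trans hi)).2.1.le.trans (he1 (hmi.2 j hj).le)
  · obtain ⟨j, hj, hj'⟩ := he4 i hilim _ hlt
    exact (hj'.trans (((hm j (hj.trans hi)).2.2.1).trans (hx.strictMono (hmi.2 j hj)))).false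

/-- For an obedient sequence `f` and any `g`, the sets `{θ | f ξ θ ≤ g θ}` stabilize modulo
bounded sets. -/
theorem Obedient.exists_stable {b : Set Cardinal.{u}} {μ l : Cardinal.{u}}
    (P : Progressive b μ l) (hμ : succ (succ (succ l)) < μ)
    {e : Ordinal.{u} → Ordinal.{u} → Ordinal.{u}} (he : IsLadder (succ (succ (succ l))) e)
    {f : Ordinal.{u} → Cardinal.{u} → Ordinal.{u}} (hf : Obedient b μ (succ (succ (succ l))) e f)
    (g : Cardinal.{u} → Ordinal.{u}) :
    ∃ ξ₀ < (succ μ).ord, ∀ ξ, ξ₀ ≤ ξ → ξ < (succ μ).ord →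
      ∃ ν < μ, ∀ θ ∈ b, ν < θ → f ξ₀ θ ≤ g θ → f ξ θ ≤ g θ := by
  have hρ : (succ l).IsRegular := isRegular_succ P.inf
  have hτ : (succ (succ (succ l))).IsRegular :=
    isRegular_succ (hρ.1.trans (le_succ _))
  have hμreg := P.reg_succ
  obtain ⟨C, hC, hguess⟩ := exists_club_guess hρ
  set τ := succ (succ (succ l))
  have hτμ : τ.ord < (succ μ).ord := ord_lt_ord.2 (hμ.trans (lt_succ μ))
  have hμ0 : 0 < μ := zero_le.trans_lt P.lt_sup
  by_contra! H
  have hN : ∀ ξ, ∃ ξ', ξ < (succ μ).ord → ξ' < (succ μ).ord ∧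
      ∀ ν < μ, ∃ θ ∈ b, ν < θ ∧ f ξ θ ≤ g θ ∧ g θ < f ξ' θ := by
    intro ξ
    by_cases hξ : ξ < (succ μ).ord
    · obtain ⟨ξ', -, h, h'⟩ := H ξ hξ
      exact ⟨ξ', fun _ => ⟨h, h'⟩⟩
    · exact ⟨0, fun h => (hξ h).elim⟩
  choose N hN using hN
  -- One bounded exceptional set has to serve all `k ∈ C α` up to `i` at once.
  set Dom : Ordinal.{u} → Ordinal.{u} → (Ordinal.{u} → Ordinal.{u}) → Ordinal.{u} → Prop :=
    fun α i x η => ∃ ν < μ, ∀ θ ∈ b, ν < θ → ∀ k ∈ C α, k ≤ i → f (x k) θ ≤ f η θ with hDom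
  have hη : ∀ α i x, ∃ η < (succ μ).ord,
      (∃ η' < (succ μ).ord, Dom α i x η') → Dom α i x η := by
    intro α i x
    by_cases h : ∃ η' < (succ μ).ord, Dom α i x η'
    · obtain ⟨η', h1, h2⟩ := h
      exact ⟨η', h1, fun _ => h2⟩
    · exact ⟨0, hμreg.ord_pos, fun h' => (h h').elim⟩
  choose η hημ hη using hη
  -- The guess that will succeed is not yet known, so the recursion passes the witness `η α i x` for
  -- all `α < τ`; this witness depends only on the history.
  set step : Ordinal.{u} → (Ordinal.{u} → Ordinal.{u}) → Ordinal.{u} :=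
    fun i x => max (N (x i)) (⨆ α : Iio τ.ord, η α i x) with hstep
  have hlt : ∀ i < (succ μ).ord, contSeq step i < (succ μ).ord := fun i hi =>
    contSeq_lt_ord hμreg (fun j _ x hx => max_lt (hN _ (hx j)).1
      (iSup_Iio_lt_ord hμreg (by rw [card_ord]; exact hμ.trans (lt_succ μ))
        fun α => hημ _ _ _)) hi
  have hnormal : IsNormal (contSeq step) := contSeq_isNormal
  obtain ⟨m, hm, hme⟩ := contSeq_eq_ladder he hτ hnormal
  obtain ⟨α, hατ, hαcof, hαunb, hαcl⟩ := hguess m hm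
  set x := contSeq step with hx
  have hδ : x τ.ord < (succ μ).ord := hlt _ hτμ
  have hαlim : IsSuccLimit α := by
    rw [← one_lt_cof_iff, hαcof]
    exact one_lt_aleph0.trans_le hρ.1
  have hxlt : ∀ i < α, x i < (succ μ).ord := fun i hi => hlt i (hi.trans (hατ.trans hτμ))
  -- On the guessed set the ladder at `x τ.ord` coincides with `x`, so obedience gives domination
  -- everywhere. Hence witnesses for `Dom` exist, and the recursion has passed one before `x (i +
  -- 1)`.
  have hle : ∀ i ∈ C α, ∀ θ ∈ b, f (x i) θ ≤ f (x τ.ord) θ := by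
    intro i hi θ hθ
    have hiτ : i < τ.ord := (hC α i hi).trans hατ
    have h := hme i hiτ (hαcl i hi)
    have h' := hf.le _ hδ i hiτ (by rw [← h]; exact hnormal.strictMono hiτ) θ hθ
    rwa [← h] at h'
  have hdom : ∀ i < α, ∃ ν < μ, ∀ θ ∈ b, ν < θ → ∀ k ∈ C α, k ≤ i →
      f (x k) θ ≤ f (x (i + 1)) θ := by
    intro i hi
    have h1 : Dom α i (hist x i) (η α i (hist x i)) := hη α i (hist x i) ⟨x τ.ord, hδ, 0, hμ0,
      fun θ hθ _ k hk hki => by rw [hist_of_le hki]; exact hle k hk θ hθ⟩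
    have h2 : η α i (hist x i) < x (i + 1) := by
      refine lt_of_le_of_lt ?_ (step_lt_contSeq (step := step) (lt_add_one i))
      exact (Ordinal.le_iSup (fun α : Iio τ.ord => η α i (hist x i)) ⟨α, hατ⟩).trans
        (le_max_right _ _)
    obtain ⟨ν, hν, h3⟩ := h1
    obtain ⟨ν', hν', h4⟩ := hf.blt _ (hxlt _ (hαlim.succ_lt hi)) _ h2
    refine ⟨max ν ν', max_lt hν hν', fun θ hθ hνθ k hk hki => ?_⟩
    have h5 := h3 θ hθ ((le_max_left _ _).trans_lt hνθ) k hk hki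
    rw [hist_of_le hki] at h5
    exact h5.trans (h4 θ hθ ((le_max_right _ _).trans_lt hνθ)).le
  have hn : ∀ i, ∃ n, i < α → n ∈ C α ∧ i + 1 < n := by
    intro i
    by_cases hi : i < α
    · obtain ⟨n, hn, hin⟩ := hαunb _ (hαlim.succ_lt hi)
      exact ⟨n, fun _ => ⟨hn, hin⟩⟩
    · exact ⟨0, fun h => (hi h).elim⟩
  choose n hn using hn
  obtain ⟨θ₀, hθ₀, -⟩ := P.unb 0 hμ0
  have hθ : ∀ i, ∃ θ : b, i < α → f (x (i + 1)) θ ≤ g θ ∧ g θ < f (x (n i)) θ ∧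
      ∀ k ∈ C α, k ≤ i → f (x k) θ ≤ f (x (i + 1)) θ := by
    intro i
    by_cases hi : i < α
    · obtain ⟨ν, hν, h1⟩ := hdom i hi
      obtain ⟨hnC, hni⟩ := hn i hi
      have hi1 : i + 1 < α := hαlim.succ_lt hi
      have h2 : N (x (i + 1)) < x (n i) := by
        refine lt_of_le_of_lt ?_ (step_lt_contSeq (step := step) hni)
        rw [hstep]
        dsimp only
        rw [hist_of_le le_rfl]
        exact le_max_left _ _
      obtain ⟨ν', hν', h3⟩ := hf.blt _ (hxlt _ (hC α _ hnC)) _ h2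
      obtain ⟨θ, hθ, hνθ, h4, h5⟩ := (hN _ (hxlt _ hi1)).2 (max ν ν') (max_lt hν hν')
      exact ⟨⟨θ, hθ⟩, fun _ => ⟨h4, h5.trans (h3 θ hθ ((le_max_right _ _).trans_lt hνθ)),
        h1 θ hθ ((le_max_left _ _).trans_lt hνθ)⟩⟩
    · exact ⟨⟨θ₀, hθ₀⟩, fun h => (hi h).elim⟩
  choose t ht using hθ
  -- Since `cf α = l⁺ > |b|`, two points `y < n y < z` share the same `θ`. There `g θ < f (x (n y))
  -- θ ≤ f (x (z + 1)) θ ≤ g θ`.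
  obtain ⟨θ, hθ⟩ := exists_const_unbounded (α := α) (X := b) (s := C α) (by
      rw [hαcof]
      exact P.card.trans_lt (Cardinal.lift_lt.2 (lt_succ l)))
    (fun y hy => by
      obtain ⟨z, hz, hyz⟩ := hαunb y hy
      exact ⟨z, hz, hyz, hC α z hz⟩) t
  obtain ⟨y, hyC, -, hyα, hyθ⟩ := hθ 0 (zero_le.trans_lt (hC α _ (hn 0 hαlim.bot_lt).1))
  obtain ⟨hnC, hny⟩ := hn y hyα
  obtain ⟨z, hzC, hyz, hzα, hzθ⟩ := hθ (n y) (hC α _ hnC)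
  have h1 := ht y hyα
  have h2 := ht z hzα
  rw [hyθ] at h1
  rw [hzθ] at h2
  exact (h1.2.1.trans_le ((h2.2.2 _ hnC hyz.le).trans h2.1)).false

end Pcf
-- Scales from cofinal families modulo ultrafilters.
namespace Pcf
open Cardinal Ordinal Set Order Filter

/-- Every unbounded set of cardinals below `μ` has an unbounded subset of size at most the
cofinality of `μ`. -/
theorem exists_unbounded_subset {μ : Cardinal.{u}} {x : Set Cardinal.{u}}
    (hx : ∀ ν < μ, ∃ θ ∈ x, ν < θ) :
    ∃ c ⊆ x, (∀ ν < μ, ∃ θ ∈ c, ν < θ) ∧ #c ≤ lift.{u + 1} μ.ord.cof := by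
  obtain ⟨s, hs, hs', hcard⟩ := exists_cofinal_set μ.ord
  choose t ht ht' using fun α : s => hx (α : Ordinal.{u}).card (lt_ord.1 (hs α.2))
  refine ⟨range t, ?_, fun ν hν => ?_, ?_⟩
  · rintro _ ⟨α, rfl⟩
    exact ht α
  · obtain ⟨α, hα, hνα⟩ := hs' _ (ord_lt_ord.2 hν)
    refine ⟨_, ⟨⟨α, hα⟩, rfl⟩, lt_of_le_of_lt ?_ (ht' ⟨α, hα⟩)⟩
    exact (ord_le.1 hνα)
  · rw [← hcard]
    exact mk_range_le

section
variable {b : Set Cardinal.{u}} {μ l : Cardinal.{u}}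

theorem BLT.eventually {f g : Cardinal.{u} → Ordinal.{u}} (h : BLT b μ f g)
    {D : Filter Cardinal.{u}} (hb : b ∈ D) (hD : ∀ ν < μ, ∀ᶠ θ in D, ν < θ) :
    ∀ᶠ θ in D, f θ < g θ := by
  obtain ⟨ν, hν, h⟩ := h
  filter_upwards [hb, hD ν hν] with θ h1 h2 using h θ h1 h2

/-- `p` enumerates a family of `μ⁺` functions that is cofinal in `∏ b` modulo `D`, where `D` is
an ultrafilter none of whose elements is bounded below `μ`. -/
structure CofinalFamily (b : Set Cardinal.{u}) (μ : Cardinal.{u}) (D : Ultrafilter Cardinal.{u})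
    (p : Ordinal.{u} → Cardinal.{u} → Ordinal.{u}) : Prop where
  unb : ∀ ν < μ, ∀ᶠ θ in (D : Filter Cardinal.{u}), ν < θ
  below : ∀ ξ < (succ μ).ord, Below b (p ξ)
  cofinal : ∀ g, Below b g →
    ∃ ξ < (succ μ).ord, ∀ᶠ θ in (D : Filter Cardinal.{u}), g θ ≤ p ξ θ

/-- If every unbounded subset of `b` of size `cf μ` carries an unbounded ultrafilter modulo which
`∏ b` has cofinality at most `μ⁺`, then `∏ b` has an increasing cofinal sequence of length `μ⁺`
modulo bounded sets. -/
theorem Progressive.exists_scale (P : Progressive b μ l) (hμ : succ (succ (succ l)) < μ)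
    (hb : ∀ θ ∈ b, succ (succ (succ l)) < θ)
    (H : ∀ c ⊆ b, (∀ ν < μ, ∃ θ ∈ c, ν < θ) → #c ≤ lift.{u + 1} μ.ord.cof →
      ∃ D : Ultrafilter Cardinal.{u}, c ∈ D ∧ ∃ p, CofinalFamily b μ D p) :
    ∃ f : Ordinal.{u} → Cardinal.{u} → Ordinal.{u}, (∀ ξ < (succ μ).ord, Below b (f ξ)) ∧
      (∀ ξ < (succ μ).ord, ∀ η < ξ, BLT b μ (f η) (f ξ)) ∧
      ∀ g, Below b g → ∃ ξ < (succ μ).ord, BLE b μ g (f ξ) := by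
  have hμreg := P.reg_succ
  have hμlim : IsSuccLimit (succ μ).ord := isSuccLimit_ord hμreg.1
  have hρ : (succ l).IsRegular := isRegular_succ P.inf
  have hρb : ∀ θ ∈ b, succ l < θ := fun θ hθ =>
    ((lt_succ _).trans (lt_succ _)).trans (hb θ hθ)
  obtain ⟨e, he⟩ := exists_isLadder (τ := succ (succ (succ l)))
    (isRegular_succ (hρ.1.trans (le_succ _)))
  by_contra! Hn
  have key : ∀ r : Ordinal.{u} → Cardinal.{u} → Ordinal.{u},
      ∃ (f : Ordinal.{u} → Cardinal.{u} → Ordinal.{u}) (g : Cardinal.{u} → Ordinal.{u})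
        (D : Ultrafilter Cardinal.{u}) (p : Ordinal.{u} → Cardinal.{u} → Ordinal.{u}),
        (∀ ξ < (succ μ).ord, Below b (r ξ)) →
          Obedient b μ (succ (succ (succ l))) e f ∧
          (∀ ξ < (succ μ).ord, ∀ θ ∈ b, r ξ θ ≤ f ξ θ) ∧ Below b g ∧
          (∀ ξ < (succ μ).ord, ∀ᶠ θ in (D : Filter Cardinal.{u}), f ξ θ ≤ g θ) ∧
          b ∈ D ∧ CofinalFamily b μ D p := by
    intro r
    by_cases hr : ∀ ξ < (succ μ).ord, Below b (r ξ)
    swap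
    · exact ⟨0, 0, pure 0, 0, fun h => (hr h).elim⟩
    obtain ⟨f, hf⟩ := P.exists_obedient hb hr e
    have hfo : Obedient b μ (succ (succ (succ l))) e f :=
      ⟨fun ξ hξ => (hf ξ hξ).1, fun ξ hξ => (hf ξ hξ).2.2.1, fun ξ hξ => (hf ξ hξ).2.2.2⟩
    obtain ⟨g, hg, hfg⟩ := Hn f hfo.below hfo.blt
    -- As `g` escapes `f`, the stable set where `f ξ₀ ≤ g` is unbounded. An ultrafilter
    -- concentrating on it makes `g` an upper bound of the whole sequence.
    obtain ⟨ξ₀, hξ₀, hst⟩ := hfo.exists_stable P hμ he g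
    obtain ⟨c, hc, hcunb, hcard⟩ := exists_unbounded_subset (μ := μ)
      (x := {θ | θ ∈ b ∧ f ξ₀ θ ≤ g θ}) fun ν hν => by
        have h := hfg ξ₀ hξ₀
        unfold BLE at h
        push Not at h
        obtain ⟨θ, h1, h2, h3⟩ := h ν hν
        exact ⟨θ, ⟨h1, h3.le⟩, h2⟩
    obtain ⟨D, hcD, p, hp⟩ := H c (fun θ hθ => (hc hθ).1) hcunb hcard
    have hbD : b ∈ D := mem_of_superset hcD fun θ hθ => (hc hθ).1
    have h0 : ∀ᶠ θ in (D : Filter Cardinal.{u}), f ξ₀ θ ≤ g θ :=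
      mem_of_superset hcD fun θ hθ => (hc hθ).2
    refine ⟨f, g, D, p, fun _ => ⟨hfo, fun ξ hξ => (hf ξ hξ).2.1, hg, fun ξ hξ => ?_, hbD, hp⟩⟩
    rcases lt_or_ge ξ ξ₀ with h | h
    · filter_upwards [h0, (hfo.blt _ hξ₀ _ h).eventually hbD hp.unb] with θ h1 h2
      exact h2.le.trans h1
    · obtain ⟨ν, hν, h'⟩ := hst ξ h hξ
      filter_upwards [h0, hbD, hp.unb ν hν] with θ h1 h2 h3 using h' θ h2 h3 h1
  choose F G D p key using key
  -- Iterate `l⁺` times: the sequence at stage `α` must dominate all earlier sequences, their bounds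
  -- and the corresponding cofinal families.
  let R : Ordinal.{u} → Ordinal.{u} → Cardinal.{u} → Ordinal.{u} :=
    WellFounded.fix (lt_wf : WellFounded ((· < ·) : Ordinal.{u} → Ordinal.{u} → Prop))
      fun α rec ξ θ => ⨆ β : Iio α, max (F (rec β β.2) ξ θ)
        (max (G (rec β β.2) θ) (p (rec β β.2) ξ θ))
  have hR : ∀ α ξ θ, R α ξ θ = ⨆ β : Iio α, max (F (R β) ξ θ)
        (max (G (R β) θ) (p (R β) ξ θ)) := by
    intro α ξ θ
    conv_lhs => rw [show R α = _ from WellFounded.fix_eq _ _ α]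
  have hle : ∀ α β, β < α → ∀ ξ θ, max (F (R β) ξ θ) (max (G (R β) θ) (p (R β) ξ θ)) ≤
      R α ξ θ := by
    intro α β hβ ξ θ
    rw [hR α]
    exact Ordinal.le_iSup (fun β : Iio α => max (F (R β) ξ θ)
      (max (G (R β) θ) (p (R β) ξ θ))) ⟨β, hβ⟩
  have hRbelow : ∀ α < (succ l).ord, ∀ ξ < (succ μ).ord, Below b (R α ξ) := by
    intro α
    induction α using WellFoundedLT.induction with
    | ind α ih =>
      intro hα ξ hξ θ hθ
      rw [hR]
      refine iSup_Iio_lt_ord (P.reg θ hθ) ((lt_ord.1 hα).trans (hρb θ hθ)) fun β => ?_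
      have h := key (R β) (ih β β.2 (lt_trans β.2 hα))
      exact max_lt (h.1.below ξ hξ θ hθ)
        (max_lt (h.2.2.1 θ hθ) (h.2.2.2.2.2.below ξ hξ θ hθ))
  have hkey := fun α hα => key (R α) (hRbelow α hα)
  set h : Cardinal.{u} → Ordinal.{u} := fun θ => ⨆ α : Iio (succ l).ord, G (R α) θ with hh
  have hGh : ∀ α < (succ l).ord, ∀ θ, G (R α) θ ≤ h θ := fun α hα θ =>
    Ordinal.le_iSup (fun α : Iio (succ l).ord => G (R α) θ) ⟨α, hα⟩
  have hhb : Below b h := fun θ hθ =>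
    iSup_Iio_lt_ord (P.reg θ hθ) (by rw [card_ord]; exact hρb θ hθ)
      fun α => (hkey α α.2).2.2.1 θ hθ
  have hz : ∀ α, ∃ ζ < (succ μ).ord, α < (succ l).ord →
      ∀ᶠ θ in (D (R α) : Filter Cardinal.{u}), h θ ≤ p (R α) ζ θ := by
    intro α
    by_cases hα : α < (succ l).ord
    · obtain ⟨ζ, hζ, hζ'⟩ := (hkey α hα).2.2.2.2.2.cofinal h hhb
      exact ⟨ζ, hζ, fun _ => hζ'⟩
    · exact ⟨0, hμreg.ord_pos, fun h => (hα h).elim⟩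
  choose z hzμ hz using hz
  set ξ := ⨆ α : Iio (succ l).ord, z α with hξdef
  have hξ : ξ < (succ μ).ord := iSup_Iio_lt_ord hμreg (by
    rw [card_ord]
    exact ((lt_succ _).trans (lt_succ _)).trans (hμ.trans (lt_succ μ))) fun α => hzμ α
  -- Modulo `D (R α)`, the sequence at stage `α` is bounded by `G (R α) ≤ h`; being increasing, it
  -- is strictly below `h` at `ξ`. On the other side `h` lies below a member of the family `p (R
  -- α)`, which stage `α + 1` dominates.
  have hpick : ∀ α : Iio (succ l).ord, ∃ θ : b, F (R α) ξ θ < h θ ∧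
      h θ ≤ F (R ((α : Ordinal.{u}) + 1)) ξ θ := by
    intro ⟨α, hα⟩
    obtain ⟨h1, h2, h3, h4, h5, h6⟩ := hkey α hα
    have hα1 : α + 1 < (succ l).ord := IsRegular.add_one_lt hρ hα
    obtain ⟨k1, k2, -⟩ := hkey _ hα1
    have hξ1 : ξ + 1 < (succ μ).ord := IsRegular.add_one_lt hμreg hξ
    have e1 := (h1.blt _ hξ1 ξ (lt_add_one ξ)).eventually h5 h6.unb
    have e2 := h4 _ hξ1
    have e3 := hz α hα
    have hzξ : z α ≤ ξ := Ordinal.le_iSup (fun α : Iio (succ l).ord => z α) ⟨α, hα⟩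
    have e4 : ∀ᶠ θ in (D (R α) : Filter Cardinal.{u}),
        F (R (α + 1)) (z α) θ ≤ F (R (α + 1)) ξ θ := by
      rcases hzξ.eq_or_lt with h | h
      · rw [h]
        exact Eventually.of_forall fun _ => le_rfl
      · filter_upwards [(k1.blt _ hξ _ h).eventually h5 h6.unb] with θ hθ using hθ.le
    obtain ⟨θ, a1, a2, a3, a4, a5⟩ := (e1.and (e2.and (e3.and (e4.and
      (eventually_mem_set.2 h5))))).exists
    refine ⟨⟨θ, a5⟩, a1.trans_le (a2.trans (hGh α hα θ)), a3.trans (le_trans ?_ a4)⟩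
    refine le_trans ?_ (k2 _ (hzμ α) θ a5)
    exact ((le_max_right _ _).trans (le_max_right _ _)).trans (hle _ _ (lt_add_one α) _ _)
  choose t ht using hpick
  -- Stages increase everywhere on `b`, so at a common `θ` one would get `h θ ≤ F (R β) ξ θ < h θ`.
  -- Thus `t` injects `l⁺` into `b`.
  have hmono : ∀ α β : Iio (succ l).ord, α < β → t α ≠ t β := by
    intro α β hαβ heq
    have h1 := (ht α).2
    have h2 := (ht β).1
    rw [heq] at h1
    refine (h1.trans_lt' h2).not_ge ?_
    rcases (add_one_le_iff.2 (show (α : Ordinal.{u}) < β from hαβ)).eq_or_lt with h | h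
    · rw [h]
    · refine le_trans ?_ ((hkey β β.2).2.1 ξ hξ _ (t β).2)
      exact (le_max_left _ _).trans (hle _ _ h _ _)
  have hinj : Function.Injective t := by
    intro α β h
    rcases lt_trichotomy α β with h' | h' | h'
    · exact (hmono _ _ h' h).elim
    · exact h'
    · exact (hmono _ _ h' h.symm).elim
  have := (mk_le_of_injective hinj).trans P.card
  rw [Cardinal.mk_Iio_ordinal, Cardinal.lift_le, card_ord] at this
  exact (lt_succ l).not_ge this

end
end Pcf
-- Least upper bounds in scale systems and domination.
namespace Pcf
open Cardinal Ordinal Set Order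

/-- A strictly increasing continuous sequence `k` of length `l.ord`, considered from index `i₀`
on, together with, at each limit `i`, a sequence `f i` of length `(k i)⁺` that is increasing and
cofinal in `∏_{j < i} (k j)⁺` modulo bounded sets. -/
structure ScaleSystem (l : Cardinal.{u}) (k : Ordinal.{u} → Cardinal.{u}) (i₀ : Ordinal.{u})
    (f : Ordinal.{u} → Ordinal.{u} → Ordinal.{u} → Ordinal.{u}) : Prop where
  reg : l.IsRegular
  unc : ℵ₀ < l
  mono : ∀ i < l.ord, ∀ j < i, k j < k i
  sup : ∀ i < l.ord, IsSuccLimit i → ∀ ν < k i, ∃ j < i, ν < k j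
  large : ∀ j, i₀ ≤ j → j < l.ord → succ l < k j
  below : ∀ i, IsSuccLimit i → i₀ < i → i < l.ord → ∀ ξ < (succ (k i)).ord, ∀ j, i₀ ≤ j → j < i →
    f i ξ j < (succ (k j)).ord
  le : ∀ i, IsSuccLimit i → i₀ < i → i < l.ord → ∀ ξ < (succ (k i)).ord, ∀ η < ξ,
    ∃ t < i, ∀ j, t ≤ j → j < i → f i η j ≤ f i ξ j
  cofinal : ∀ i, IsSuccLimit i → i₀ < i → i < l.ord → ∀ F : Ordinal.{u} → Ordinal.{u},
    (∀ j, i₀ ≤ j → j < i → F j < (succ (k j)).ord) →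
    ∃ ξ < (succ (k i)).ord, ∃ t < i, ∀ j, t ≤ j → j < i → F j ≤ f i ξ j

/-- `F` is a least upper bound of the first `β` functions `f η`, modulo sets bounded below `i`. -/
def IsLubBelow (f : Ordinal.{u} → Ordinal.{u} → Ordinal.{u}) (i β : Ordinal.{u})
    (F : Ordinal.{u} → Ordinal.{u}) : Prop :=
  (∀ η < β, ∃ t < i, ∀ j, t ≤ j → j < i → f η j ≤ F j) ∧
  ∀ Φ : Ordinal.{u} → Ordinal.{u}, (∀ η < β, ∃ t < i, ∀ j, t ≤ j → j < i → f η j ≤ Φ j) →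
    ∃ t < i, ∀ j, t ≤ j → j < i → F j ≤ Φ j

namespace ScaleSystem
variable {l : Cardinal.{u}} {k : Ordinal.{u} → Cardinal.{u}} {i₀ : Ordinal.{u}}
  {f : Ordinal.{u} → Ordinal.{u} → Ordinal.{u} → Ordinal.{u}}

theorem reg_succ (W : ScaleSystem l k i₀ f) {j : Ordinal.{u}} (h : i₀ ≤ j) (h' : j < l.ord) :
    (succ (k j)).IsRegular :=
  isRegular_succ (W.unc.le.trans ((le_succ l).trans (W.large j h h').le))

/-- Above every function there is one that is simultaneously, at every limit `i`, a least upper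
bound of an initial segment of the scale `f i`. -/
theorem exists_lub (W : ScaleSystem l k i₀ f) {Q : Ordinal.{u} → Ordinal.{u}}
    (hQ : ∀ j, i₀ ≤ j → j < l.ord → Q j < (succ (k j)).ord) :
    ∃ F : Ordinal.{u} → Ordinal.{u},
      (∀ j, i₀ ≤ j → j < l.ord → F j < (succ (k j)).ord) ∧ (∀ j, Q j ≤ F j) ∧
      ∀ i, IsSuccLimit i → i₀ < i → i < l.ord →
        ∃ β < (succ (k i)).ord, IsLubBelow (f i) i β F := by
  classical
  have hρ : (succ l).IsRegular := isRegular_succ W.reg.1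
  have hB : ∀ (i : Ordinal.{u}) (F : Ordinal.{u} → Ordinal.{u}), ∃ ξ : Ordinal.{u},
      IsSuccLimit i → i₀ < i → i < l.ord →
      (∀ j, i₀ ≤ j → j < l.ord → F j < (succ (k j)).ord) →
      ξ < (succ (k i)).ord ∧ ∃ t < i, ∀ j, t ≤ j → j < i → F j ≤ f i ξ j := by
    intro i F
    by_cases h : IsSuccLimit i ∧ i₀ < i ∧ i < l.ord ∧
        ∀ j, i₀ ≤ j → j < l.ord → F j < (succ (k j)).ord
    · obtain ⟨h1, h2, h3, h4⟩ := h
      obtain ⟨ξ, hξ, h⟩ := W.cofinal i h1 h2 h3 F fun j hj hji => h4 j hj (hji.trans h3)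
      exact ⟨ξ, fun _ _ _ _ => ⟨hξ, h⟩⟩
    · exact ⟨0, fun h1 h2 h3 h4 => (h ⟨h1, h2, h3, h4⟩).elim⟩
  choose B hB using hB
  -- Each stage lies above a member of `f i` that bounds the previous stages, for all limits `i`
  -- simultaneously. After `l⁺` stages the functions `R ν` and these members interleave.
  let R : Ordinal.{u} → Ordinal.{u} → Ordinal.{u} :=
    WellFounded.fix (lt_wf : WellFounded ((· < ·) : Ordinal.{u} → Ordinal.{u} → Prop))
      fun ν rec j => max (Q j) (⨆ μ : Iio ν, max (rec μ μ.2 j) (⨆ i : Iio l.ord,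
        if IsSuccLimit (i : Ordinal.{u}) ∧ i₀ < i ∧ j < i then f i (B i (rec μ μ.2)) j else 0))
  have hR : ∀ ν j, R ν j = max (Q j) (⨆ μ : Iio ν, max (R μ j) (⨆ i : Iio l.ord,
      if IsSuccLimit (i : Ordinal.{u}) ∧ i₀ < i ∧ j < i then f i (B i (R μ)) j else 0)) := by
    intro ν j
    conv_lhs => rw [show R ν = _ from WellFounded.fix_eq _ _ ν]
  have hle : ∀ ν μ, μ < ν → ∀ j, max (R μ j) (⨆ i : Iio l.ord,
      if IsSuccLimit (i : Ordinal.{u}) ∧ i₀ < i ∧ j < i then f i (B i (R μ)) j else 0) ≤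
      R ν j := by
    intro ν μ hμ j
    rw [hR ν]
    exact (Ordinal.le_iSup (fun μ : Iio ν => max (R μ j) (⨆ i : Iio l.ord,
      if IsSuccLimit (i : Ordinal.{u}) ∧ i₀ < i ∧ j < i then f i (B i (R μ)) j else 0))
      ⟨μ, hμ⟩).trans (le_max_right _ _)
  have hmono : ∀ ν μ, μ < ν → ∀ j, R μ j ≤ R ν j := fun ν μ hμ j =>
    (le_max_left _ _).trans (hle ν μ hμ j)
  have hBle : ∀ ν μ, μ < ν → ∀ i, IsSuccLimit i → i₀ < i → i < l.ord → ∀ j < i,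
      f i (B i (R μ)) j ≤ R ν j := by
    intro ν μ hμ i h1 h2 h3 j hj
    refine le_trans ?_ ((le_max_right _ _).trans (hle ν μ hμ j))
    refine le_trans ?_ (Ordinal.le_iSup (fun i : Iio l.ord =>
      if IsSuccLimit (i : Ordinal.{u}) ∧ i₀ < i ∧ j < i then f i (B i (R μ)) j else 0) ⟨i, h3⟩)
    simp only [h1, h2, hj, and_self, if_true, le_rfl]
  have hRb : ∀ ν < (succ l).ord, ∀ j, i₀ ≤ j → j < l.ord → R ν j < (succ (k j)).ord := by
    intro ν
    induction ν using WellFoundedLT.induction with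
    | ind ν ih =>
      intro hν j hj hjl
      have hl : succ l < succ (k j) := (W.large j hj hjl).trans (lt_succ _)
      rw [hR]
      refine max_lt (hQ j hj hjl) (iSup_Iio_lt_ord (W.reg_succ hj hjl)
        ((lt_ord.1 hν).trans hl) fun μ => max_lt (ih μ μ.2 (lt_trans μ.2 hν) j hj hjl) ?_)
      refine iSup_Iio_lt_ord (W.reg_succ hj hjl)
        (by rw [card_ord]; exact (lt_succ l).trans hl) fun i => ?_
      split_ifs with h
      · exact W.below i h.1 h.2.1 i.2 _
          (hB i (R μ) h.1 h.2.1 i.2 (ih μ μ.2 (lt_trans μ.2 hν))).1 j hj h.2.2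
      · exact (W.reg_succ hj hjl).ord_pos
  refine ⟨fun j => ⨆ ν : Iio (succ l).ord, R ν j, fun j hj hjl => ?_, fun j => ?_,
    fun i h1 h2 h3 => ?_⟩
  · exact iSup_Iio_lt_ord (W.reg_succ hj hjl)
      (by rw [card_ord]; exact (W.large j hj hjl).trans (lt_succ _)) fun ν => hRb ν ν.2 j hj hjl
  · refine le_trans ?_ (Ordinal.le_iSup (fun ν : Iio (succ l).ord => R ν j) ⟨0, hρ.ord_pos⟩)
    dsimp only
    rw [hR]
    exact le_max_left _ _
  · have hRF : ∀ ν < (succ l).ord, ∀ j, R ν j ≤ ⨆ ν : Iio (succ l).ord, R ν j := fun ν hν j =>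
      Ordinal.le_iSup (fun ν : Iio (succ l).ord => R ν j) ⟨ν, hν⟩
    have hireg := W.reg_succ h2.le h3
    have hBi : ∀ ν < (succ l).ord, B i (R ν) < (succ (k i)).ord ∧
        ∃ t < i, ∀ j, t ≤ j → j < i → R ν j ≤ f i (B i (R ν)) j :=
      fun ν hν => hB i (R ν) h1 h2 h3 (hRb ν hν)
    refine ⟨⨆ ν : Iio (succ l).ord, B i (R ν) + 1, ?_, fun η hη => ?_, fun Φ hΦ => ?_⟩
    · exact iSup_Iio_lt_ord hireg
        (by rw [card_ord]; exact (W.large i h2.le h3).trans (lt_succ _))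
        fun ν => IsRegular.add_one_lt hireg (hBi ν ν.2).1
    · obtain ⟨⟨ν, hν⟩, hην⟩ := Ordinal.lt_iSup_add_one_iff.1 hη
      have h4 : ∀ j < i, f i (B i (R ν)) j ≤ ⨆ ν : Iio (succ l).ord, R ν j := fun j hj =>
        (hBle _ _ (lt_add_one ν) i h1 h2 h3 j hj).trans
          (hRF _ (IsRegular.add_one_lt hρ hν) j)
      rcases hην.eq_or_lt with rfl | h
      · exact ⟨0, h1.bot_lt, fun j _ hj => h4 j hj⟩
      · obtain ⟨t, ht, h5⟩ := W.le i h1 h2 h3 _ (hBi ν hν).1 η h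
        exact ⟨t, ht, fun j htj hj => (h5 j htj hj).trans (h4 j hj)⟩
    · have hex : ∀ ν, ∃ t : Iio i, ν < (succ l).ord → ∀ j, ↑t ≤ j → j < i → R ν j ≤ Φ j := by
        intro ν
        by_cases hν : ν < (succ l).ord
        · obtain ⟨t, ht, h4⟩ := (hBi ν hν).2
          obtain ⟨t', ht', h5⟩ := hΦ (B i (R ν)) (Ordinal.lt_iSup_add_one
            (fun ν : Iio (succ l).ord => B i (R ν)) ⟨ν, hν⟩)
          exact ⟨⟨max t t', max_lt ht ht'⟩, fun _ j htj hj =>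
            (h4 j ((le_max_left _ _).trans htj) hj).trans
              (h5 j ((le_max_right _ _).trans htj) hj)⟩
        · exact ⟨⟨0, h1.bot_lt⟩, fun h => (hν h).elim⟩
      choose t ht using hex
      -- The length `l⁺` exceeds `|i|`, so one threshold `t₀ < i` serves unboundedly many stages and
      -- therefore their supremum.
      obtain ⟨t₀, ht₀⟩ := exists_const_unbounded (α := (succ l).ord) (X := Iio i) (s := univ)
        (by
          rw [hρ.cof_ord]
          exact (mk_Iio_lt h3).trans (Cardinal.lift_lt.2 (lt_succ l)))
        (fun x hx => ⟨x + 1, mem_univ _, lt_add_one x, IsRegular.add_one_lt hρ hx⟩) t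
      refine ⟨t₀, t₀.2, fun j htj hj => Ordinal.iSup_le fun ν => ?_⟩
      obtain ⟨y, -, hνy, hy, hyt⟩ := ht₀ ν ν.2
      exact (hmono _ _ hνy j).trans (ht y hy j (by rwa [hyt]) hj)

/-- Let `g s`, for `s` in a stationary set `S` of limits, be scales in `∏ (a ∩ k s)`, and let `T`
be another stationary set of limits. There are families of `(k i)⁺` functions on `a ∩ k i`, for
`i ∈ T`, such that any function on `a` is dominated, for some `i ∈ T`, by a member of the `i`-th
family, modulo bounded sets. -/
theorem exists_dominating (W : ScaleSystem l k i₀ f) {a : Set Cardinal.{u}}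
    (hareg : ∀ θ ∈ a, θ.IsRegular) (hal : ∀ θ ∈ a, l < θ) {S T : Set Ordinal.{u}}
    (hSlim : ∀ s ∈ S, IsSuccLimit s ∧ i₀ < s ∧ s < l.ord)
    (hTlim : ∀ s ∈ T, IsSuccLimit s ∧ i₀ < s ∧ s < l.ord)
    (hS : ∀ m : Ordinal.{u} → Ordinal.{u}, (∀ i < l.ord, m i < l.ord) → ∃ s ∈ S, Closed m s)
    (hT : ∀ m : Ordinal.{u} → Ordinal.{u}, (∀ i < l.ord, m i < l.ord) → ∃ s ∈ T, Closed m s)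
    {g : Ordinal.{u} → Ordinal.{u} → Cardinal.{u} → Ordinal.{u}}
    (hgb : ∀ s ∈ S, ∀ ξ < (succ (k s)).ord, ∀ θ ∈ a, θ < k s → g s ξ θ < θ.ord)
    (hgm : ∀ s ∈ S, ∀ ξ < (succ (k s)).ord, ∀ η < ξ, ∃ ν < k s, ∀ θ ∈ a, θ < k s → ν < θ →
      g s η θ ≤ g s ξ θ)
    (hgc : ∀ s ∈ S, ∀ G, Below a G → ∃ ξ < (succ (k s)).ord, ∃ ν < k s, ∀ θ ∈ a, θ < k s →
      ν < θ → G θ ≤ g s ξ θ) :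
    ∃ H : Ordinal.{u} → Ordinal.{u} → Cardinal.{u} → Ordinal.{u},
      (∀ i ∈ T, ∀ ξ < (succ (k i)).ord, ∀ θ ∈ a, θ < k i → H i ξ θ < θ.ord) ∧
      ∀ G, Below a G → ∃ i ∈ T, ∃ ξ < (succ (k i)).ord, ∃ ν < k i, ∀ θ ∈ a, θ < k i → ν < θ →
        G θ ≤ H i ξ θ := by
  classical
  -- `φ i ξ` depends on `i` and `ξ` alone. This allows the families `H i` to be fixed before `G` is
  -- given.
  have hφ : ∀ i ξ, ∃ φ : Ordinal.{u} → Ordinal.{u}, IsSuccLimit i → i₀ < i → i < l.ord →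
      (∀ j, i₀ ≤ j → j < i → φ j < (succ (k j)).ord) ∧
      ∀ F : Ordinal.{u} → Ordinal.{u}, (∀ j, i₀ ≤ j → j < i → F j < (succ (k j)).ord) →
        IsLubBelow (f i) i ξ F → IsLubBelow (f i) i ξ φ := by
    intro i ξ
    by_cases h : ∃ F : Ordinal.{u} → Ordinal.{u},
        (∀ j, i₀ ≤ j → j < i → F j < (succ (k j)).ord) ∧ IsLubBelow (f i) i ξ F
    · obtain ⟨F, hF, hF'⟩ := h
      exact ⟨F, fun _ _ _ => ⟨hF, fun _ _ _ => hF'⟩⟩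
    · exact ⟨fun _ => 0, fun h1 h2 h3 => ⟨fun j hj hji => (W.reg_succ hj (hji.trans h3)).ord_pos,
        fun F hF hF' => (h ⟨F, hF, hF'⟩).elim⟩⟩
  choose φ hφ using hφ
  refine ⟨fun i ξ θ => ⨆ s : Iio i, if (s : Ordinal.{u}) ∈ S ∧ θ < k s then g s (φ i ξ s) θ else 0,
    fun i hi ξ hξ θ hθ hθi => ?_, fun G hG => ?_⟩
  · obtain ⟨h1, h2, h3⟩ := hTlim i hi
    refine iSup_Iio_lt_ord (hareg θ hθ) ((lt_ord.1 h3).trans (hal θ hθ)) fun s => ?_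
    split_ifs with h
    · exact hgb s h.1 _ ((hφ i ξ h1 h2 h3).1 s (hSlim s h.1).2.1.le s.2) θ hθ h.2
    · exact (hareg θ hθ).ord_pos
  have hq : ∀ s, ∃ ξ, s ∈ S → ξ < (succ (k s)).ord ∧ ∃ ν < k s, ∀ θ ∈ a, θ < k s → ν < θ →
      G θ ≤ g s ξ θ := by
    intro s
    by_cases hs : s ∈ S
    · obtain ⟨ξ, h1, h2⟩ := hgc s hs G hG
      exact ⟨ξ, fun _ => ⟨h1, h2⟩⟩
    · exact ⟨0, fun h => (hs h).elim⟩
  choose q hq using hq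
  obtain ⟨F, hFb, hQF, hF⟩ := W.exists_lub (Q := fun j => if j ∈ S then q j else 0) (by
    intro j hj hjl
    split_ifs with h
    · exact (hq j h).1
    · exact (W.reg_succ hj hjl).ord_pos)
  have ht : ∀ s, ∃ t, s ∈ S → t < s ∧ ∀ θ ∈ a, θ < k s → k t < θ → G θ ≤ g s (F s) θ := by
    intro s
    by_cases hs : s ∈ S
    · obtain ⟨h1, h2, h3⟩ := hSlim s hs
      obtain ⟨hq1, ν, hν, hq2⟩ := hq s hs
      have hqF := hQF s
      simp only [if_pos hs] at hqF
      obtain ⟨ν', hν', h4⟩ : ∃ ν < k s, ∀ θ ∈ a, θ < k s → ν < θ →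
          g s (q s) θ ≤ g s (F s) θ := by
        rcases hqF.eq_or_lt with h | h
        · exact ⟨ν, hν, fun θ _ _ _ => by rw [h]⟩
        · exact hgm s hs _ (hFb s h2.le h3) _ h
      obtain ⟨t, hts, ht⟩ := W.sup s h3 h1 (max ν ν') (max_lt hν hν')
      exact ⟨t, fun _ => ⟨hts, fun θ hθ hθs htθ =>
        (hq2 θ hθ hθs (((le_max_left _ _).trans_lt ht).trans htθ)).trans
          (h4 θ hθ hθs (((le_max_right _ _).trans_lt ht).trans htθ))⟩⟩
    · exact ⟨0, fun h => (hs h).elim⟩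
  choose t ht using ht
  -- A weak form of Fodor's lemma for the regressive function `t` on the stationary set `S`.
  obtain ⟨t₀, ht₀, hunb⟩ : ∃ t₀ < l.ord, ∀ x < l.ord, ∃ s ∈ S, x < s ∧ t s ≤ t₀ := by
    by_contra! h
    have hm : ∀ x, ∃ y, x < l.ord → y < l.ord ∧ ∀ s ∈ S, y < s → x < t s := by
      intro x
      by_cases hx : x < l.ord
      · obtain ⟨y, h1, h2⟩ := h x hx
        exact ⟨y, fun _ => ⟨h1, h2⟩⟩
      · exact ⟨0, fun h => (hx h).elim⟩
    choose m hm using hm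
    obtain ⟨s, hs, hsm⟩ := hS m fun i hi => (hm i hi).1
    have h1 := (ht s hs).1
    exact ((hm _ (h1.trans (hSlim s hs).2.2)).2 s hs (hsm.2 _ h1)).false
  have hn : ∀ x, ∃ s, x < l.ord → s ∈ S ∧ x < s ∧ t s ≤ t₀ := by
    intro x
    by_cases hx : x < l.ord
    · obtain ⟨s, h⟩ := hunb x hx
      exact ⟨s, fun _ => h⟩
    · exact ⟨0, fun h => (hx h).elim⟩
  choose n hn using hn
  obtain ⟨i, hiT, hicl⟩ := hT (fun x => max t₀ (n x)) fun x hx =>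
    max_lt ht₀ (hSlim _ (hn x hx).1).2.2
  obtain ⟨h1, h2, h3⟩ := hTlim i hiT
  have ht₀i : t₀ < i := (le_max_left _ _).trans_lt (hicl.2 0 h1.bot_lt)
  obtain ⟨β, hβ, hlub⟩ := hF i h1 h2 h3
  have hFi : ∀ j, i₀ ≤ j → j < i → F j < (succ (k j)).ord := fun j hj hji =>
    hFb j hj (hji.trans h3)
  have hlub' := (hφ i β h1 h2 h3).2 F hFi hlub
  -- Least upper bounds are unique modulo bounded sets, so `F` and `φ i β` agree between `w` and
  -- `i`.
  obtain ⟨t₁, ht₁, h4⟩ := hlub.2 _ hlub'.1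
  obtain ⟨t₂, ht₂, h5⟩ := hlub'.2 _ hlub.1
  have hu : max t₀ (max t₁ t₂) < i := max_lt ht₀i (max_lt ht₁ ht₂)
  set w := max t₀ (max t₁ t₂) with hw
  refine ⟨i, hiT, β, hβ, k w, W.mono i h3 _ hu, fun θ hθ hθi hwθ => ?_⟩
  -- Some `s ∈ S` with `w < s < i`, `θ < k s` and `t s ≤ t₀` gives `G θ ≤ g s (F s) θ = g s (φ i β
  -- s) θ ≤ H i β θ`.
  obtain ⟨j, hji, hθj⟩ := W.sup i h3 h1 θ hθi
  have hji' : max j w < i := max_lt hji hu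
  obtain ⟨hsS, hjs, hts⟩ := hn (max j w) (hji'.trans h3)
  have hsi : n (max j w) < i := (le_max_right _ _).trans_lt (hicl.2 _ hji')
  set s := n (max j w) with hs
  have hθs : θ < k s := hθj.trans (W.mono s (hsi.trans h3) j ((le_max_left _ _).trans_lt hjs))
  have hws : w < s := (le_max_right _ _).trans_lt hjs
  have hktw : k (t s) ≤ k w := by
    rcases (hts.trans (le_max_left _ _) : t s ≤ w).eq_or_lt with h | h
    · rw [h]
    · exact (W.mono w (hu.trans h3) _ h).le
  have hFφ : F s = φ i β s := le_antisymm
    (h4 s (((le_max_left _ _).trans (le_max_right _ _)).trans hws.le) hsi)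
    (h5 s (((le_max_right _ _).trans (le_max_right _ _)).trans hws.le) hsi)
  refine ((ht s hsS).2 θ hθ hθs (hktw.trans_lt hwθ)).trans ?_
  refine le_trans ?_ (Ordinal.le_iSup (fun s : Iio i =>
    if (s : Ordinal.{u}) ∈ S ∧ θ < k s then g s (φ i β s) θ else 0) ⟨s, hsi⟩)
  simp only [hsS, hθs, and_self, if_true, hFφ, le_rfl]

end ScaleSystem
end Pcf
-- Cofinalities of ultraproducts, `pp` and `pcf`.
namespace Pcf
open Cardinal Ordinal Set Order Filter

/-- A product of a small set of cardinals has small cofinality. -/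
theorem exists_cofProd_eq {a : Set Cardinal.{u}} {c : Cardinal.{u}} (hc : #a = lift.{u + 1} c)
    {μ : Cardinal.{u}} (ha : ∀ θ ∈ a, θ ≤ μ) (D : Ultrafilter a) :
    ∃ χ : Cardinal.{u}, cofProd a D = lift.{u + 1} χ := by
  have hle : cofProd a D ≤ lift.{u + 1} (μ ^ c) := by
    refine (Order.cof_le_cardinalMk (UProd a D)).trans ?_
    have h : #(UProd a D) = Cardinal.prod fun θ : a => #(Set.Iio (θ : Cardinal.{u}).ord) :=
      Cardinal.mk_pi _
    rw [h, lift_power, ← hc, ← Cardinal.prod_const']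
    refine Cardinal.prod_le_prod _ _ fun θ => ?_
    rw [Cardinal.mk_Iio_ordinal, card_ord, Cardinal.lift_le]
    exact ha θ θ.2
  obtain ⟨χ, hχ⟩ := mem_range_lift_of_le hle
  exact ⟨χ, hχ.symm⟩

/-- A bound on the cofinality of an ultraproduct, in terms of functions on a set of cardinals. -/
theorem exists_family_of_cofProd_le {c b : Set Cardinal.{u}} (hc : ∀ θ ∈ c, θ.IsRegular)
    (hb : ∀ θ ∈ b, θ.IsRegular) {D : Ultrafilter c}
    (hbD : ∀ᶠ θ : c in (D : Filter c), (θ : Cardinal.{u}) ∈ b) {χ : Cardinal.{u}}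
    (hχ : cofProd c D ≤ lift.{u + 1} χ) :
    ∃ p : Ordinal.{u} → Cardinal.{u} → Ordinal.{u}, (∀ ξ, Below b (p ξ)) ∧
      ∀ g, Below b g → ∃ ξ < χ.ord, ∀ᶠ θ in (D.map Subtype.val : Filter Cardinal.{u}),
        g θ ≤ p ξ θ := by
  classical
  obtain ⟨s, hs, hcard⟩ := Order.exists_cof_eq (UProd c D)
  have hle : #s ≤ #(Iio χ.ord) := by
    rw [hcard, Cardinal.mk_Iio_ordinal, card_ord]
    exact hχ
  obtain ⟨φ⟩ := hle
  refine ⟨fun ξ θ => if h : θ ∈ c ∧ ∃ x : s, (φ x : Ordinal.{u}) = ξ then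
    ((h.2.choose : UProd c D) ⟨θ, h.1⟩ : Ordinal.{u}) else 0, fun ξ θ hθ => ?_, fun g hg => ?_⟩
  · dsimp only
    split_ifs with h
    · exact ((h.2.choose : UProd c D) ⟨θ, h.1⟩).2
    · exact (hb θ hθ).ord_pos
  -- Values of `g` outside the product are replaced by `0`; this happens only off `b`, hence on a
  -- `D`-null set.
  · let g' : UProd c D := fun θ =>
      if h : g θ < (θ : Cardinal.{u}).ord then ⟨g θ, h⟩ else ⟨0, (hc θ θ.2).ord_pos⟩
    obtain ⟨x, hx, hgx⟩ := hs g'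
    refine ⟨φ ⟨x, hx⟩, (φ ⟨x, hx⟩).2, ?_⟩
    rw [Ultrafilter.coe_map, eventually_map]
    filter_upwards [hbD, (hgx : ∀ᶠ θ in (D : Filter c), g' θ ≤ x θ)] with θ h1 h2
    have H : ∃ y : s, (φ y : Ordinal.{u}) = φ ⟨x, hx⟩ := ⟨_, rfl⟩
    have hch : H.choose = ⟨x, hx⟩ := φ.injective (Subtype.ext H.choose_spec)
    rw [dif_pos ⟨θ.2, H⟩, hch]
    have hlt := hg θ h1
    simp only [g', dif_pos hlt] at h2
    exact h2

/-- Fewer functions than the cofinality of an ultraproduct are bounded. -/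
theorem exists_bound_of_lt_cofProd {c : Set Cardinal.{u}} {D : Ultrafilter c} {χ : Cardinal.{u}}
    (hχ : lift.{u + 1} χ < cofProd c D)
    {h : Ordinal.{u} → Cardinal.{u} → Ordinal.{u}} (hh : ∀ ξ < χ.ord, Below c (h ξ)) :
    ∃ g, Below c g ∧ ∀ ξ < χ.ord, ∀ᶠ θ : c in (D : Filter c), h ξ θ < g θ := by
  classical
  let F : Iio χ.ord → UProd c D := fun ξ θ => ⟨h ξ θ, hh ξ ξ.2 θ θ.2⟩
  have hnot : ¬ IsCofinal (range F) := by
    intro hcof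
    have h1 : cofProd c D ≤ #(range F) := Order.cof_le hcof
    have h2 : #(range F) ≤ lift.{u + 1} χ := by
      refine mk_range_le.trans ?_
      rw [Cardinal.mk_Iio_ordinal, card_ord]
    exact (h1.trans h2).not_gt hχ
  unfold IsCofinal at hnot
  push Not at hnot
  obtain ⟨g, hg⟩ := hnot
  refine ⟨fun θ => if hθ : θ ∈ c then (g ⟨θ, hθ⟩ : Ordinal.{u}) else 0, fun θ hθ => ?_,
    fun ξ hξ => ?_⟩
  · simp only [dif_pos hθ]
    exact (g ⟨θ, hθ⟩).2
  · have h1 : ¬ ∀ᶠ θ in (D : Filter c), g θ ≤ F ⟨ξ, hξ⟩ θ := hg _ ⟨⟨ξ, hξ⟩, rfl⟩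
    rw [← Ultrafilter.eventually_not] at h1
    filter_upwards [h1] with θ hθ
    simp only [dif_pos θ.2]
    exact not_le.1 hθ

/-- The final segments of `c` are nonempty and directed, so they generate a proper filter. -/
theorem exists_unbounded_ultrafilter {c : Set Cardinal.{u}} {μ : Cardinal.{u}}
    (hc : ∀ ν < μ, ∃ θ ∈ c, ν < θ) (hμ : 0 < μ) :
    ∃ D : Ultrafilter c, ∀ ν < μ, ∀ᶠ θ : c in (D : Filter c), ν < (θ : Cardinal.{u}) := by
  have : Nonempty (Iio μ) := ⟨⟨0, hμ⟩⟩
  have hne : (⨅ ν : Iio μ, 𝓟 {θ : c | (ν : Cardinal.{u}) < θ}).NeBot := by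
    refine iInf_neBot_of_directed' (fun ν ν' => ?_) fun ν => ?_
    · refine ⟨max ν ν', le_principal_iff.2 (mem_principal.2 ?_),
        le_principal_iff.2 (mem_principal.2 ?_)⟩
      · intro θ hθ
        exact lt_of_le_of_lt (Subtype.coe_le_coe.2 (le_max_left ν ν')) hθ
      · intro θ hθ
        exact lt_of_le_of_lt (Subtype.coe_le_coe.2 (le_max_right ν ν')) hθ
    · obtain ⟨θ, hθ, hνθ⟩ := hc ν ν.2
      exact principal_neBot_iff.2 ⟨⟨θ, hθ⟩, hνθ⟩
  refine ⟨Ultrafilter.of (⨅ ν : Iio μ, 𝓟 {θ : c | (ν : Cardinal.{u}) < θ}), fun ν hν => ?_⟩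
  refine Ultrafilter.of_le _ ?_
  exact mem_iInf_of_mem (⟨ν, hν⟩ : Iio μ) (mem_principal_self _)

/-- An unbounded set of cardinals below `μ` has at least `cf μ` elements. -/
theorem lift_cof_le_of_unbounded {c : Set Cardinal.{u}} {μ : Cardinal.{u}}
    (hc : ∀ θ ∈ c, θ < μ) (hc' : ∀ ν < μ, ∃ θ ∈ c, ν < θ) :
    lift.{u + 1} μ.ord.cof ≤ #c := by
  rw [lift_cof, ← cof_Iio]
  refine (Order.cof_le (s := range fun θ : c =>
    (⟨(θ : Cardinal.{u}).ord, ord_lt_ord.2 (hc θ θ.2)⟩ : Iio μ.ord)) fun x => ?_).trans mk_range_le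
  obtain ⟨θ, hθ, hxθ⟩ := hc' _ (lt_ord.1 x.2)
  exact ⟨_, ⟨⟨θ, hθ⟩, rfl⟩, Subtype.coe_le_coe.1 (lt_ord.2 hxθ).le⟩

/-- The ultraproducts occurring in the definition of the pseudopower of `μ` have cofinality
greater than `μ`. -/
theorem Progressive.lift_lt_cofProd {b c : Set Cardinal.{u}} {μ l : Cardinal.{u}}
    (P : Progressive b μ l) (hcb : c ⊆ b) {D : Ultrafilter c}
    (hD : ∀ ν < μ, ∀ᶠ θ : c in (D : Filter c), ν < (θ : Cardinal.{u})) :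
    lift.{u + 1} μ < cofProd c D := by
  by_contra! hle
  have hcD : ∀ᶠ θ : c in (D : Filter c), (θ : Cardinal.{u}) ∈ b :=
    Eventually.of_forall fun θ => hcb θ.2
  obtain ⟨p, hp, hp'⟩ := exists_family_of_cofProd_le (fun θ hθ => P.reg θ (hcb hθ)) P.reg hcD hle
  -- Any `μ` functions are strictly bounded modulo bounded sets, so they cannot be cofinal modulo
  -- `D`.
  obtain ⟨g, hg, hpg⟩ := P.exists_bound_of_lt fun ξ (_ : ξ < μ.ord) => hp ξ
  obtain ⟨ξ, hξ, h⟩ := hp' g hg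
  have h' := (hpg ξ hξ).eventually (D := (D.map Subtype.val : Filter Cardinal.{u}))
    (by rw [Ultrafilter.coe_map, mem_map]; exact hcD) (by
      intro ν hν
      rw [Ultrafilter.coe_map, eventually_map]
      exact hD ν hν)
  obtain ⟨θ, h1, h2⟩ := (h.and h').exists
  exact h1.not_gt h2

theorem Progressive.mem_ppSet {b c : Set Cardinal.{u}} {μ l : Cardinal.{u}}
    (P : Progressive b μ l) (hcb : c ⊆ b) (hc : ∀ ν < μ, ∃ θ ∈ c, ν < θ)
    (hcard : #c ≤ lift.{u + 1} μ.ord.cof) {D : Ultrafilter c}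
    (hD : ∀ ν < μ, ∀ᶠ θ : c in (D : Filter c), ν < (θ : Cardinal.{u})) :
    ∃ χ ∈ ppSet μ, cofProd c D = lift.{u + 1} χ := by
  have hcard' := hcard.antisymm
    (lift_cof_le_of_unbounded (fun θ hθ => P.lt θ (hcb hθ)) hc)
  obtain ⟨χ, hχ⟩ := exists_cofProd_eq hcard' (fun θ hθ => (P.lt θ (hcb hθ)).le) D
  exact ⟨χ, ⟨c, fun θ hθ => ⟨P.reg θ (hcb hθ), P.lt θ (hcb hθ)⟩, hc, hcard', D, hD, hχ⟩, hχ⟩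

/-- The pseudopower of `μ` is greater than `μ`. -/
theorem Progressive.succ_le_pp {b : Set Cardinal.{u}} {μ l : Cardinal.{u}}
    (P : Progressive b μ l) : succ μ ≤ pp μ := by
  obtain ⟨c, hcb, hc, hcard⟩ := exists_unbounded_subset P.unb
  obtain ⟨D, hD⟩ := exists_unbounded_ultrafilter hc (zero_le.trans_lt P.lt_sup)
  obtain ⟨χ, hχ, hχ'⟩ := P.mem_ppSet hcb hc hcard hD
  have h := P.lift_lt_cofProd hcb hD
  rw [hχ', Cardinal.lift_lt] at h
  exact (succ_le_of_lt h).trans (le_csSup (bddAbove_ppSet μ) hχ)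

/-- If the pseudopower of `μ` is `μ⁺`, then there are scales of length `μ⁺`. -/
theorem Progressive.exists_scale_of_pp {b : Set Cardinal.{u}} {μ l : Cardinal.{u}}
    (P : Progressive b μ l) (hμ : succ (succ (succ l)) < μ)
    (hb : ∀ θ ∈ b, succ (succ (succ l)) < θ) (hpp : pp μ = succ μ) :
    ∃ f : Ordinal.{u} → Cardinal.{u} → Ordinal.{u}, (∀ ξ < (succ μ).ord, Below b (f ξ)) ∧
      (∀ ξ < (succ μ).ord, ∀ η < ξ, BLT b μ (f η) (f ξ)) ∧
      ∀ g, Below b g → ∃ ξ < (succ μ).ord, BLE b μ g (f ξ) := by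
  refine P.exists_scale hμ hb fun c hcb hc hcard => ?_
  obtain ⟨D, hD⟩ := exists_unbounded_ultrafilter hc (zero_le.trans_lt P.lt_sup)
  obtain ⟨χ, hχ, hχ'⟩ := P.mem_ppSet hcb hc hcard hD
  have hle : cofProd c D ≤ lift.{u + 1} (succ μ) := by
    rw [hχ', Cardinal.lift_le, ← hpp]
    exact le_csSup (bddAbove_ppSet μ) hχ
  obtain ⟨p, hp, hp'⟩ := exists_family_of_cofProd_le (fun θ hθ => P.reg θ (hcb hθ)) P.reg
    (Eventually.of_forall fun θ => hcb θ.2) hle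
  refine ⟨D.map Subtype.val, ?_, p, fun ν hν => ?_, fun ξ _ => hp ξ, hp'⟩
  · rw [Ultrafilter.mem_map]
    exact mem_of_superset univ_mem fun θ _ => θ.2
  · rw [Ultrafilter.coe_map, eventually_map]
    exact hD ν hν

/-- If all cardinals in `pcf a` are at most `μ⁺`, where `b ⊆ a`, then there are scales of length
`μ⁺` in `∏ b`. -/
theorem Progressive.exists_scale_of_pcf {a b : Set Cardinal.{u}} {μ l : Cardinal.{u}}
    (P : Progressive b μ l) (hμ : succ (succ (succ l)) < μ)
    (hb : ∀ θ ∈ b, succ (succ (succ l)) < θ) (hba : b ⊆ a) (hareg : ∀ θ ∈ a, θ.IsRegular)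
    (ha : ∀ θ ∈ a, θ ≤ μ) {d : Cardinal.{u}} (hcarda : #a ≤ lift.{u + 1} d)
    (hpcf : ∀ χ ∈ pcf a, χ ≤ succ μ) :
    ∃ f : Ordinal.{u} → Cardinal.{u} → Ordinal.{u}, (∀ ξ < (succ μ).ord, Below b (f ξ)) ∧
      (∀ ξ < (succ μ).ord, ∀ η < ξ, BLT b μ (f η) (f ξ)) ∧
      ∀ g, Below b g → ∃ ξ < (succ μ).ord, BLE b μ g (f ξ) := by
  refine P.exists_scale hμ hb fun c hcb hc hcard => ?_
  obtain ⟨D, hD⟩ := exists_unbounded_ultrafilter hc (zero_le.trans_lt P.lt_sup)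
  -- Transferred to `a`, the ultrafilter has its cofinality in `pcf a`, which is bounded by `μ⁺`.
  set D' : Ultrafilter a := D.map (inclusion (hcb.trans hba)) with hD'
  obtain ⟨e, he⟩ := mem_range_lift_of_le hcarda
  obtain ⟨χ, hχ⟩ := exists_cofProd_eq he.symm ha D'
  have hle : cofProd a D' ≤ lift.{u + 1} (succ μ) := by
    rw [hχ, Cardinal.lift_le]
    exact hpcf χ ⟨D', hχ⟩
  have hc' : ∀ᶠ θ : a in (D' : Filter a), (θ : Cardinal.{u}) ∈ c := by
    rw [hD', Ultrafilter.coe_map, eventually_map]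
    exact Eventually.of_forall fun θ => θ.2
  obtain ⟨p, hp, hp'⟩ := exists_family_of_cofProd_le hareg P.reg
    (hc'.mono fun θ hθ => hcb hθ) hle
  refine ⟨D'.map Subtype.val, ?_, p, fun ν hν => ?_, fun ξ _ => hp ξ, hp'⟩
  · rw [Ultrafilter.mem_map]
    exact hc'
  · rw [Ultrafilter.coe_map, eventually_map, hD', Ultrafilter.coe_map, eventually_map]
    exact hD ν hν

end Pcf
-- Continuous sequences of cardinals: their scale systems and clubs.
namespace Pcf
open Cardinal Ordinal Set Order Filter

/-- A strictly increasing continuous sequence `k` of cardinals of length `l.ord`, cofinal in `κ`,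
whose terms with index at least `i₀` are large compared to `l`. -/
structure CardSeq (κ l : Cardinal.{u}) (k : Ordinal.{u} → Cardinal.{u}) (i₀ : Ordinal.{u}) :
    Prop where
  reg : l.IsRegular
  unc : ℵ₀ < l
  start : i₀ < l.ord
  lt : ∀ i < l.ord, k i < κ
  mono : ∀ i < l.ord, ∀ j < i, k j < k i
  sup : ∀ i < l.ord, IsSuccLimit i → ∀ ν < k i, ∃ j < i, ν < k j
  cofinal : ∀ ν < κ, ∃ i < l.ord, ν < k i
  large : ∀ j, i₀ ≤ j → j < l.ord → succ (succ (succ l)) < k j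

namespace CardSeq
variable {κ l : Cardinal.{u}} {k : Ordinal.{u} → Cardinal.{u}} {i₀ : Ordinal.{u}}
  (W : CardSeq κ l k i₀)
include W

theorem mono' {i j : Ordinal.{u}} (hi : i < l.ord) (hj : j ≤ i) : k j ≤ k i := by
  rcases hj.eq_or_lt with rfl | h
  · rfl
  · exact (W.mono i hi j h).le

theorem lt_of_lt {i j : Ordinal.{u}} (hi : i < l.ord) (h : k i < k j) : i < j := by
  by_contra! h'
  exact (W.mono' hi h').not_gt h

theorem inj {i j : Ordinal.{u}} (hi : i < l.ord) (hj : j < l.ord) (h : k i = k j) : i = j := by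
  rcases lt_trichotomy i j with h' | h' | h'
  · exact ((W.mono j hj i h').ne h).elim
  · exact h'
  · exact ((W.mono i hi j h').ne h.symm).elim

theorem succ_lt {i j : Ordinal.{u}} (hi : i < l.ord) (hlim : IsSuccLimit i) (hj : j < i) :
    succ (k j) < k i := by
  have hj1 : j + 1 < i := hlim.succ_lt hj
  exact (succ_le_of_lt (W.mono _ (hj1.trans hi) j (lt_add_one j))).trans_lt (W.mono i hi _ hj1)

theorem aleph0_le {j : Ordinal.{u}} (hj : i₀ ≤ j) (hjl : j < l.ord) : ℵ₀ ≤ k j :=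
  W.unc.le.trans ((((le_succ l).trans (le_succ _)).trans (le_succ _)).trans (W.large j hj hjl).le)

omit W in
/-- The set of successors of the cardinals in the sequence. -/
def succs (k : Ordinal.{u} → Cardinal.{u}) (i₀ i : Ordinal.{u}) : Set Cardinal.{u} :=
  (fun j => succ (k j)) '' Ico i₀ i

omit W in
theorem mk_succs_le {i : Ordinal.{u}} (hi : i.card ≤ l) :
    #(succs k i₀ i) ≤ Cardinal.lift.{u + 1} l := by
  refine mk_image_le.trans ((mk_le_mk_of_subset Ico_subset_Iio_self).trans ?_)
  rw [Cardinal.mk_Iio_ordinal, Cardinal.lift_le]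
  exact hi

theorem reg_of_mem_succs {i : Ordinal.{u}} (hi : i ≤ l.ord) {θ : Cardinal.{u}}
    (hθ : θ ∈ succs k i₀ i) : θ.IsRegular := by
  obtain ⟨j, hj, rfl⟩ := hθ
  exact isRegular_succ (W.aleph0_le hj.1 (hj.2.trans_le hi))

theorem large_of_mem_succs {i : Ordinal.{u}} (hi : i ≤ l.ord) {θ : Cardinal.{u}}
    (hθ : θ ∈ succs k i₀ i) : succ (succ (succ l)) < θ := by
  obtain ⟨j, hj, rfl⟩ := hθ
  exact (W.large j hj.1 (hj.2.trans_le hi)).trans (lt_succ _)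

theorem progressive {a : Set Cardinal.{u}} {i : Ordinal.{u}} (hi : i < l.ord)
    (hlim : IsSuccLimit i) (hi₀ : i₀ < i) (hareg : ∀ θ ∈ a, θ.IsRegular)
    (hbig : ∀ θ ∈ a, succ (succ (succ l)) < θ) (hcard : #a ≤ Cardinal.lift.{u + 1} l)
    (hsub : succs k i₀ i ⊆ a) : Progressive (a ∩ Iio (k i)) (k i) l where
  reg θ hθ := hareg θ hθ.1
  lt θ hθ := hθ.2
  unb ν hν := by
    obtain ⟨j, hj, hνj⟩ := W.sup i hi hlim ν hν
    have hj' : max j i₀ < i := max_lt hj hi₀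
    refine ⟨succ (k (max j i₀)), ⟨hsub ⟨_, ⟨le_max_right _ _, hj'⟩, rfl⟩,
      W.succ_lt hi hlim hj'⟩, ?_⟩
    exact hνj.trans_le ((W.mono' (hj'.trans hi) (le_max_left _ _)).trans (le_succ _))
  card := (mk_le_mk_of_subset inter_subset_left).trans hcard
  gt θ hθ := ((lt_succ l).trans ((lt_succ _).trans (lt_succ _))).trans (hbig θ hθ.1)
  inf := W.unc.le
  lt_sup := ((lt_succ l).trans ((lt_succ _).trans (lt_succ _))).trans (W.large i hi₀.le hi)

/-- The hypothesis on `pcf` provides a system of scales along the sequence. -/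
theorem exists_scaleSystem
    (hpcf : ∀ i < l.ord, IsSuccLimit i →
      ∀ χ ∈ pcf ((fun j => succ (k j)) '' Iio i), χ ≤ succ (k i)) (hinf : ∀ i < l.ord, ℵ₀ ≤ k i) :
    ∃ f, ScaleSystem l k i₀ f := by
  classical
  have key : ∀ i, ∃ f : Ordinal.{u} → Cardinal.{u} → Ordinal.{u},
      IsSuccLimit i → i₀ < i → i < l.ord →
      (∀ ξ < (succ (k i)).ord, Below (succs k i₀ i) (f ξ)) ∧
      (∀ ξ < (succ (k i)).ord, ∀ η < ξ, BLT (succs k i₀ i) (k i) (f η) (f ξ)) ∧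
      ∀ g, Below (succs k i₀ i) g → ∃ ξ < (succ (k i)).ord,
        BLE (succs k i₀ i) (k i) g (f ξ) := by
    intro i
    by_cases h : IsSuccLimit i ∧ i₀ < i ∧ i < l.ord
    swap
    · exact ⟨fun _ _ => 0, fun h1 h2 h3 => (h ⟨h1, h2, h3⟩).elim⟩
    obtain ⟨h1, h2, h3⟩ := h
    have hsub : succs k i₀ i ∩ Iio (k i) = succs k i₀ i := by
      refine inter_eq_left.2 ?_
      rintro _ ⟨j, hj, rfl⟩
      exact W.succ_lt h3 h1 hj.2
    have P := W.progressive h3 h1 h2 (fun θ => W.reg_of_mem_succs h3.le)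
      (fun θ => W.large_of_mem_succs h3.le) (mk_succs_le (lt_ord.1 h3).le) Subset.rfl
    rw [hsub] at P
    obtain ⟨f, hf⟩ := P.exists_scale_of_pcf (W.large i h2.le h3)
      (fun θ => W.large_of_mem_succs h3.le) (a := (fun j => succ (k j)) '' Iio i) (d := i.card)
      (image_mono Ico_subset_Iio_self) (by
        rintro _ ⟨j, hj, rfl⟩
        exact isRegular_succ (hinf j (lt_trans hj h3))) (by
        rintro _ ⟨j, hj, rfl⟩
        exact (W.succ_lt h3 h1 hj).le) (by
        refine mk_image_le.trans ?_
        rw [Cardinal.mk_Iio_ordinal]) (hpcf i h3 h1)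
    exact ⟨f, fun _ _ _ => hf⟩
  choose f hf using key
  refine ⟨fun i ξ j => f i ξ (succ (k j)), W.reg, W.unc, W.mono, W.sup,
    fun j hj hjl => ((lt_succ _).trans (lt_succ _)).trans (W.large j hj hjl),
    fun i h1 h2 h3 ξ hξ j hj hji => ?_, fun i h1 h2 h3 ξ hξ η hη => ?_,
    fun i h1 h2 h3 F hF => ?_⟩
  · exact (hf i h1 h2 h3).1 ξ hξ _ ⟨j, ⟨hj, hji⟩, rfl⟩
  · obtain ⟨ν, hν, h⟩ := (hf i h1 h2 h3).2.1 ξ hξ η hη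
    obtain ⟨t, ht, hνt⟩ := W.sup i h3 h1 ν hν
    refine ⟨max t i₀, max_lt ht h2, fun j htj hji => ?_⟩
    refine (h _ ⟨j, ⟨(le_max_right _ _).trans htj, hji⟩, rfl⟩ (hνt.trans_le ?_)).le
    exact (W.mono' (hji.trans h3) ((le_max_left _ _).trans htj)).trans (le_succ _)
  · obtain ⟨ξ, hξ, ν, hν, h⟩ := (hf i h1 h2 h3).2.2
      (fun θ => if h : ∃ j, (i₀ ≤ j ∧ j < i) ∧ succ (k j) = θ then F h.choose else 0) (by
        intro θ hθ
        have hθ' : ∃ j, (i₀ ≤ j ∧ j < i) ∧ succ (k j) = θ := hθ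
        simp only [dif_pos hθ']
        have h4 := hF _ hθ'.choose_spec.1.1 hθ'.choose_spec.1.2
        rwa [hθ'.choose_spec.2] at h4)
    obtain ⟨t, ht, hνt⟩ := W.sup i h3 h1 ν hν
    refine ⟨ξ, hξ, max t i₀, max_lt ht h2, fun j htj hji => ?_⟩
    have hj : i₀ ≤ j ∧ j < i := ⟨(le_max_right _ _).trans htj, hji⟩
    have hj' : ∃ j', (i₀ ≤ j' ∧ j' < i) ∧ succ (k j') = succ (k j) := ⟨j, hj, rfl⟩
    have h4 := h (succ (k j)) ⟨j, hj, rfl⟩ (hνt.trans_le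
      ((W.mono' (hji.trans h3) ((le_max_left _ _).trans htj)).trans (le_succ _)))
    have h5 : hj'.choose = j := W.inj (hj'.choose_spec.1.2.trans h3) (hji.trans h3)
      (succ_injective hj'.choose_spec.2)
    beta_reduce at h4
    rwa [dif_pos hj', h5] at h4

/-- The points `k i` with `i` a limit closed under `m` form a closed unbounded subset of `κ`. -/
theorem isClub {m : Ordinal.{u} → Ordinal.{u}} (hm : ∀ i < l.ord, m i < l.ord) :
    IsClub {α : Iio κ.ord | ∃ i, IsSuccLimit i ∧ i₀ < i ∧ i < l.ord ∧ Closed m i ∧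
      (α : Ordinal.{u}) = (k i).ord} := by
  constructor
  · intro d hd hne _ x hx
    set I : Set Ordinal.{u} := {i | i₀ < i ∧ i < l.ord ∧ Closed m i ∧ IsSuccLimit i ∧
      ∃ y ∈ d, (y : Ordinal.{u}) = (k i).ord} with hI
    have hle : ∀ i ∈ I, (k i).ord ≤ x := by
      rintro i ⟨-, -, -, -, y, hy, hyi⟩
      rw [← hyi]
      exact hx.1 hy
    obtain ⟨i₁, hi₁, hxi₁⟩ := W.cofinal _ (lt_ord.1 x.2)
    have hbound : ∀ i ∈ I, i ≤ i₁ := fun i hi => by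
      refine (W.lt_of_lt hi.2.1 (lt_of_le_of_lt ?_ hxi₁)).le
      exact ord_le.1 (hle i hi)
    have hbdd : BddAbove I := ⟨i₁, hbound⟩
    have hIne : I.Nonempty := by
      obtain ⟨y, hy⟩ := hne
      obtain ⟨i, h1, h2, h3, h4, h5⟩ := hd hy
      exact ⟨i, h2, h3, h4, h1, y, hy, h5⟩
    have hsl : sSup I < l.ord := (csSup_le hIne hbound).trans_lt hi₁
    have hs₀ : i₀ < sSup I := hIne.some_mem.1.trans_le (le_csSup hbdd hIne.some_mem)
    -- The supremum is either attained, hence itself one of the limit indices, or not attained,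
    -- hence a limit.
    have hlim : IsSuccLimit (sSup I) := by
      by_cases h : sSup I ∈ I
      · exact h.2.2.2.1
      · exact (isLUB_csSup hIne hbdd).isSuccLimit_of_notMem hIne h
    refine ⟨sSup I, hlim, hs₀, hsl, Closed.sSup hIne hbdd fun i hi => hi.2.2.1, ?_⟩
    refine le_antisymm ?_ (not_lt.1 fun hlt => ?_)
    · have hub : (⟨(k (sSup I)).ord, ord_lt_ord.2 (W.lt _ hsl)⟩ : Iio κ.ord) ∈ upperBounds d := by
        intro y hy
        obtain ⟨i, h1, h2, h3, h4, h5⟩ := hd hy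
        rw [← Subtype.coe_le_coe, h5]
        exact ord_le_ord.2 (W.mono' hsl (le_csSup hbdd ⟨h2, h3, h4, h1, y, hy, h5⟩))
      exact Subtype.coe_le_coe.2 (hx.2 hub)
    · obtain ⟨j, hj, hxj⟩ := W.sup _ hsl hlim _ (lt_ord.1 hlt)
      obtain ⟨i, hi, hji⟩ := exists_lt_of_lt_csSup hIne hj
      have h1 := hxj.trans_le (W.mono' hi.2.1 hji.le)
      exact (ord_le.1 (hle i hi)).not_gt h1
  · intro x
    obtain ⟨i₁, hi₁, hxi₁⟩ := W.cofinal _ (lt_ord.1 x.2)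
    -- Including `y + 1` forces the closed point to be a limit.
    obtain ⟨i, hi, hi', hcl⟩ := exists_closed W.reg W.unc (m := fun y => max (m y) (y + 1))
      (fun y hy => max_lt (hm y hy) (IsRegular.add_one_lt W.reg hy)) (max_lt hi₁ W.start)
    refine ⟨⟨(k i).ord, ord_lt_ord.2 (W.lt i hi)⟩, ⟨i, hcl.isSuccLimit fun γ _ =>
      (lt_add_one γ).trans_le (le_max_right _ _), (le_max_right _ _).trans_lt hi', hi,
      hcl.mono fun γ _ => le_max_left _ _, rfl⟩, ?_⟩
    rw [← Subtype.coe_le_coe]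
    exact (lt_ord.2 (hxi₁.trans_le (W.mono' hi ((le_max_left _ _).trans hi'.le)))).le

end CardSeq
end Pcf
-- The contradiction from two stationary sets, and the theorem.
namespace Pcf
open Cardinal Ordinal Set Order Filter

/-- For a sequence as in the principle `(*)_κ`, the sets of limits `i` at which the pseudopower of
`k i` is `(k i)⁺`, respectively greater than `(k i)⁺`, are not both stationary. -/
theorem CardSeq.not_both_stationary {κ l : Cardinal.{u}} {k : Ordinal.{u} → Cardinal.{u}}
    {i₀ : Ordinal.{u}} (W : CardSeq κ l k i₀)
    {f : Ordinal.{u} → Ordinal.{u} → Ordinal.{u} → Ordinal.{u}} (V : ScaleSystem l k i₀ f)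
    (hS : ∀ m : Ordinal.{u} → Ordinal.{u}, (∀ i < l.ord, m i < l.ord) →
      ∃ s, (IsSuccLimit s ∧ i₀ < s ∧ s < l.ord) ∧ pp (k s) = succ (k s) ∧ Closed m s)
    (hT : ∀ m : Ordinal.{u} → Ordinal.{u}, (∀ i < l.ord, m i < l.ord) →
      ∃ s, (IsSuccLimit s ∧ i₀ < s ∧ s < l.ord) ∧ succ (k s) < pp (k s) ∧ Closed m s) :
    False := by
  classical
  set S : Set Ordinal.{u} :=
    {s | (IsSuccLimit s ∧ i₀ < s ∧ s < l.ord) ∧ pp (k s) = succ (k s)} with hSdef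
  set T : Set Ordinal.{u} :=
    {s | (IsSuccLimit s ∧ i₀ < s ∧ s < l.ord) ∧ succ (k s) < pp (k s)} with hTdef
  have hA : ∀ i, ∃ (a : Set Cardinal.{u}) (D : Ultrafilter a), i ∈ T →
      (∀ θ ∈ a, θ.IsRegular ∧ θ < k i) ∧ #a = Cardinal.lift.{u + 1} (k i).ord.cof ∧
      (∀ ν < k i, ∀ᶠ θ : a in (D : Filter a), ν < (θ : Cardinal.{u})) ∧
      Cardinal.lift.{u + 1} (succ (k i)) < cofProd a D := by
    intro i
    by_cases hi : i ∈ T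
    · have hne : (ppSet (k i)).Nonempty := by
        by_contra hne
        rw [not_nonempty_iff_eq_empty] at hne
        have := hi.2
        rw [pp, hne, csSup_empty] at this
        exact not_lt_bot this
      obtain ⟨χ, ⟨a, ha, -, hcard, D, hD, hχ⟩, hlt⟩ := exists_lt_of_lt_csSup hne hi.2
      exact ⟨a, D, fun _ => ⟨ha, hcard, hD, by rwa [hχ, Cardinal.lift_lt]⟩⟩
    · exact ⟨{0}, pure ⟨0, rfl⟩, fun h => (hi h).elim⟩
  choose A D hA using hA
  -- The successors make `a` unbounded in every relevant `k i`. Discarding the members of `A i` up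
  -- to `l⁺⁺⁺` is harmless, since `D i` contains the final segments of `A i`.
  set a : Set Cardinal.{u} := CardSeq.succs k i₀ l.ord ∪
    ⋃ i : Iio l.ord, {θ | θ ∈ A i ∧ (i : Ordinal.{u}) ∈ T ∧ succ (succ (succ l)) < θ} with ha
  have hareg : ∀ θ ∈ a, θ.IsRegular := by
    rintro θ (hθ | hθ)
    · exact W.reg_of_mem_succs le_rfl hθ
    · obtain ⟨i, h1, h2, -⟩ := mem_iUnion.1 hθ
      exact ((hA i h2).1 θ h1).1
  have hbig : ∀ θ ∈ a, succ (succ (succ l)) < θ := by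
    rintro θ (hθ | hθ)
    · exact W.large_of_mem_succs le_rfl hθ
    · obtain ⟨i, -, -, h⟩ := mem_iUnion.1 hθ
      exact h
  have hal : ∀ θ ∈ a, l < θ := fun θ hθ =>
    ((lt_succ l).trans ((lt_succ _).trans (lt_succ _))).trans (hbig θ hθ)
  have hl : ℵ₀ ≤ Cardinal.lift.{u + 1} l := aleph0_le_lift.2 W.unc.le
  have hcof : ∀ i, IsSuccLimit i → i₀ < i → i < l.ord → (k i).ord.cof ≤ l := by
    intro i h1 h2 h3
    have P := W.progressive h3 h1 h2 (fun θ => W.reg_of_mem_succs h3.le)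
      (fun θ => W.large_of_mem_succs h3.le) (CardSeq.mk_succs_le (lt_ord.1 h3).le) Subset.rfl
    exact Cardinal.lift_le.1 ((lift_cof_le_of_unbounded P.lt P.unb).trans P.card)
  have hcard : #a ≤ Cardinal.lift.{u + 1} l := by
    refine (mk_union_le _ _).trans (add_le_of_le hl (CardSeq.mk_succs_le (by rw [card_ord])) ?_)
    refine mk_iUnion_le _ |>.trans (mul_le_of_le hl ?_ (ciSup_le' fun i => ?_))
    · rw [Cardinal.mk_Iio_ordinal, card_ord]
    · by_cases hi : (i : Ordinal.{u}) ∈ T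
      · refine (mk_le_mk_of_subset (t := A i) fun θ hθ => hθ.1).trans ?_
        rw [(hA i hi).2.1, Cardinal.lift_le]
        exact hcof i hi.1.1 hi.1.2.1 i.2
      · have : {θ | θ ∈ A i ∧ (i : Ordinal.{u}) ∈ T ∧ succ (succ (succ l)) < θ} = ∅ :=
          eq_empty_of_forall_notMem fun θ hθ => hi hθ.2.1
        rw [this, Cardinal.mk_eq_zero]
        exact zero_le
  have hP : ∀ i, IsSuccLimit i → i₀ < i → i < l.ord →
      Progressive (a ∩ Iio (k i)) (k i) l := fun i h1 h2 h3 =>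
    W.progressive h3 h1 h2 hareg hbig hcard
      ((image_mono (Ico_subset_Ico_right h3.le)).trans subset_union_left)
  have hg : ∀ s, ∃ g : Ordinal.{u} → Cardinal.{u} → Ordinal.{u}, s ∈ S →
      (∀ ξ < (succ (k s)).ord, Below (a ∩ Iio (k s)) (g ξ)) ∧
      (∀ ξ < (succ (k s)).ord, ∀ η < ξ, BLT (a ∩ Iio (k s)) (k s) (g η) (g ξ)) ∧
      ∀ G, Below (a ∩ Iio (k s)) G → ∃ ξ < (succ (k s)).ord,
        BLE (a ∩ Iio (k s)) (k s) G (g ξ) := by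
    intro s
    by_cases hs : s ∈ S
    · obtain ⟨⟨h1, h2, h3⟩, h4⟩ := hs
      obtain ⟨g, hg⟩ := (hP s h1 h2 h3).exists_scale_of_pp (W.large s h2.le h3)
        (fun θ hθ => hbig θ hθ.1) h4
      exact ⟨g, fun _ => hg⟩
    · exact ⟨fun _ _ => 0, fun h => (hs h).elim⟩
  choose g hg using hg
  obtain ⟨H, hHb, hH⟩ := V.exists_dominating hareg hal (S := S) (T := T) (fun s hs => hs.1)
    (fun s hs => hs.1)
    (fun m hm => by
      obtain ⟨s, h1, h2, h3⟩ := hS m hm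
      exact ⟨s, ⟨h1, h2⟩, h3⟩)
    (fun m hm => by
      obtain ⟨s, h1, h2, h3⟩ := hT m hm
      exact ⟨s, ⟨h1, h2⟩, h3⟩)
    (g := g) (fun s hs ξ hξ θ hθ hθs => (hg s hs).1 ξ hξ θ ⟨hθ, hθs⟩)
    (fun s hs ξ hξ η hη => by
      obtain ⟨ν, hν, h⟩ := (hg s hs).2.1 ξ hξ η hη
      exact ⟨ν, hν, fun θ hθ hθs hνθ => (h θ ⟨hθ, hθs⟩ hνθ).le⟩)
    (fun s hs G hG => by
      obtain ⟨ξ, hξ, ν, hν, h⟩ := (hg s hs).2.2 G fun θ hθ => hG θ hθ.1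
      exact ⟨ξ, hξ, ν, hν, fun θ hθ hθs hνθ => h θ ⟨hθ, hθs⟩ hνθ⟩)
  -- The cofinality modulo `D i` exceeds `(k i)⁺`, so the family `H i` is bounded there.
  have hbad : ∀ i, ∃ G : Cardinal.{u} → Ordinal.{u}, i ∈ T → Below (A i) G ∧
      ∀ ξ < (succ (k i)).ord, ∀ᶠ θ : A i in (D i : Filter (A i)),
        (if (θ : Cardinal.{u}) ∈ a then H i ξ θ else 0) < G θ := by
    intro i
    by_cases hi : i ∈ T
    · obtain ⟨G, hG⟩ := exists_bound_of_lt_cofProd (hA i hi).2.2.2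
        (h := fun ξ θ => if θ ∈ a then H i ξ θ else 0) (by
          intro ξ hξ θ hθ
          dsimp only
          split_ifs with h
          · exact hHb i hi ξ hξ θ h ((hA i hi).1 θ hθ).2
          · exact ((hA i hi).1 θ hθ).1.ord_pos)
      exact ⟨G, fun _ => hG⟩
    · exact ⟨fun _ => 0, fun h => (hi h).elim⟩
  choose G hG using hbad
  -- The pointwise supremum of all the bounds `G i` lies in `∏ a`, because each `θ ∈ a` exceeds `l`.
  obtain ⟨i, hi, ξ, hξ, ν, hν, hle⟩ := hH
    (fun θ => ⨆ i : Iio l.ord, if (i : Ordinal.{u}) ∈ T ∧ θ ∈ A i then G i θ else 0) (by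
      intro θ hθ
      refine iSup_Iio_lt_ord (hareg θ hθ) (by rw [card_ord]; exact hal θ hθ) fun i => ?_
      split_ifs with h
      · exact (hG i h.1).1 θ h.2
      · exact (hareg θ hθ).ord_pos)
  obtain ⟨h1, h2, h3⟩ := hi.1
  obtain ⟨θ, h4, h5, h6⟩ := (((hG i hi).2 ξ hξ).and (((hA i hi).2.2.1 ν hν).and
    ((hA i hi).2.2.1 _ (W.large i h2.le h3)))).exists
  have hθa : (θ : Cardinal.{u}) ∈ a := Or.inr (mem_iUnion.2 ⟨⟨i, h3⟩, θ.2, hi, h6⟩)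
  rw [if_pos hθa] at h4
  have h7 := hle θ hθa ((hA i hi).1 θ θ.2).2 h5
  refine (h4.trans_le (le_trans ?_ h7)).false
  refine le_trans ?_ (Ordinal.le_iSup (fun i : Iio l.ord =>
    if (i : Ordinal.{u}) ∈ T ∧ (θ : Cardinal.{u}) ∈ A i then G i θ else 0) ⟨i, h3⟩)
  simp only [hi, θ.2, and_self, if_true, le_rfl]

end Pcf

theorem theorem2p1 (κ : Cardinal.{u}) (hκ : Pcf.IsSingular κ)
    (hcof : Cardinal.aleph0 < κ.ord.cof) (hstar : Pcf.Star κ) :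
    Pcf.ContainsClub κ {α | ∃ μ : Cardinal.{u}, Pcf.IsSingular μ ∧ (α : Ordinal.{u}) = μ.ord ∧
      Pcf.pp μ = Order.succ μ} ∨
    Pcf.ContainsClub κ {α | ∃ μ : Cardinal.{u}, Pcf.IsSingular μ ∧ (α : Ordinal.{u}) = μ.ord ∧
      Order.succ μ < Pcf.pp μ} := by
  open Pcf Cardinal Order Set in
  obtain ⟨k, hk1, hk2, hk3, hk4, hk5⟩ := hstar
  set l := κ.ord.cof with hl
  have hlim : IsSuccLimit κ := Cardinal.IsSingular.isSuccLimit ⟨hκ.1, hκ.2.ne⟩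
  obtain ⟨i₀, hi₀, hki₀⟩ := hk4 (succ (succ (succ l)))
    (hlim.succ_lt (hlim.succ_lt (hlim.succ_lt hκ.2)))
  have hmono : ∀ j < l.ord, ∀ i ≤ j, k i ≤ k j := fun j hj i hij => by
    rcases hij.eq_or_lt with rfl | h
    · rfl
    · exact (hk2 j hj i h).le
  have W : CardSeq κ l k i₀ := {
    reg := isRegular_cof (isSuccLimit_ord hκ.1)
    unc := hcof
    start := hi₀
    lt := fun i hi => (hk1 i hi).2
    mono := hk2
    sup := fun i hi hil ν hν => by
      obtain ⟨_, ⟨j, hj, rfl⟩, h⟩ := (lt_isLUB_iff (hk3 i hi hil)).1 hν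
      exact ⟨j, hj, h⟩
    cofinal := hk4
    large := fun j hj hjl => hki₀.trans_le (hmono j hjl i₀ hj) }
  obtain ⟨f, V⟩ := W.exists_scaleSystem (fun i hi hil χ hχ => (hk5 i hi hil).2 hχ)
    fun i hi => (hk1 i hi).1.1
  -- With this bound, the failure of one of the two cases at every limit closed under some `m` means
  -- that the other holds on the club of `CardSeq.isClub`.
  have hpp : ∀ i, IsSuccLimit i → i₀ < i → i < l.ord → succ (k i) ≤ pp (k i) :=
    fun i h1 h2 h3 => (W.progressive h3 h1 h2 (fun θ => W.reg_of_mem_succs h3.le)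
      (fun θ => W.large_of_mem_succs h3.le) (CardSeq.mk_succs_le (lt_ord.1 h3).le)
      Subset.rfl).succ_le_pp
  by_contra! hcon
  refine W.not_both_stationary V (fun m hm => ?_) fun m hm => ?_
  · by_contra! h
    refine hcon.2 ⟨_, W.isClub hm, ?_⟩
    rintro α ⟨i, h1, h2, h3, h4, h5⟩
    refine ⟨k i, (hk1 i h3).1, h5, (hpp i h1 h2 h3).lt_of_ne fun he => ?_⟩
    exact h i ⟨h1, h2, h3⟩ he.symm h4
  · by_contra! h
    refine hcon.1 ⟨_, W.isClub hm, ?_⟩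
    rintro α ⟨i, h1, h2, h3, h4, h5⟩
    refine ⟨k i, (hk1 i h3).1, h5, le_antisymm (not_lt.1 fun he => ?_) (hpp i h1 h2 h3)⟩
    exact h i ⟨h1, h2, h3⟩ he h4
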